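/- Let $N$ be an $n$-dimensional smooth manifold, let $\pi:T^*N\to N$ be its cotangent bundle, with tautological 1-form $\vartheta_\beta=\beta\circ\pi_*$ ($=p_i\,dq^i$) and canonical symplectic form $\Omega=d\vartheta$ ($=dp_i\wedge dq^i$). A Hamiltonian is a smooth function $H:\mathcal U\to\mathbb R$ on an open set $\mathcal U\subset T^*N$. Its motions are the smooth curves $\gamma$ in $\mathcal U$, defined on open intervals, that satisfy the variational principle of the action $\int \vartheta-H\,dt$, i.e. the action over each compact subinterval $[a,b]$ is stationary under all smooth variations in $\mathcal U$ with fixed end points. A first integral of elementary type of $H$ is a smooth real function $f$ on an open set $\mathcal V\subset\mathcal U$ (depending on the phase space point only) with $\frac{d}{dt}f(\gamma(t))=0$ along every motion, at all times with $\gamma(t)\in\mathcal V$. For $u\in\mathcal U$ let $\mathfrak{sp}^H$ be the set of germs at $u$ of smooth vector fields $Y$ with $\mathcal L_Y\Omega=0$ and $\imath_Y dH=0$, endowed with the Lie bracket of vector fields. A set $A$ of germs at $u$ of first integrals of elementary type of $H$ is said to constitute the Lie algebra $\mathfrak g\subset\mathfrak{sp}^H$ (a Lie subalgebra of the Lie algebra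 of germs of vector fields, of finite or infinite dimension) if the relation $\imath_Y\Omega=df$ makes the elements $Y$ of $\mathfrak g$ correspond to the elements $f$ of $A$ modulo additive constants (each $Y\in\mathfrak g$ comes from some $f\in A$, and each $f\in A$ gives some $Y\in\mathfrak g$), the Lie bracket of $\mathfrak g$ corresponding to the Poisson bracket: if $f,g\in A$ correspond to $Y,Z\in\mathfrak g$, then some $h\in A$ that differs from $\{f,g\}=dg(Y)$ by a constant corresponds to $[Y,Z]$. Theorem. Let $H:\mathcal U\subset T^*N\to\mathbb R$ be a Hamiltonian, let $u\in\mathcal U$ be a point with $dH|_u\ne0$, and assume that a set $A$ of germs at $u$ of first integrals of elementary type of $H$ constitutes a Lie algebra $\mathfrak g\subset\mathfrak{sp}^H$. Let $H':\mathcal U'\subset T^*N'\to\mathbb R$ be any Hamiltonian on the cotangent bundle of an $n$-dimensional smooth manifold $N'$ (for instance $N'=N$), and let $u'\in\mathcal U'$ be any point with $dH'|_{u'}\ne0$. Then there is a set $A'$ of germs at $u'$ of first integrals of elementary type of $H'$ which constitutes a Lie algebra $\mathfrak g'\subset\mathfrak{sp}^{H'}$ isomorphic to $\mathfrak g$. 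-/

import Mathlib

open Filter Topology Manifold ContDiff

noncomputable section

namespace HamSym

section VectorFieldGerms

variable {F : Type*} [NormedAddCommGroup F] [NormedSpace ℝ F]
  {B : Type*} [TopologicalSpace B] (I : ModelWithCorners ℝ F B)
  {M : Type*} [TopologicalSpace M] [ChartedSpace B M] [IsManifold I ∞ M]

/-- `Y` is a smooth vector field on some neighbourhood of `u`. -/
def IsSmoothNear (u : M) (Y : Π x : M, TangentSpace I x) : Prop :=
  ∀ᶠ x in 𝓝 u, ContMDiffAt I I.tangent ∞ (fun y => (⟨y, Y y⟩ : TangentBundle I M)) x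

variable {I} in
theorem IsSmoothNear.add {u : M} {Y Z : Π x : M, TangentSpace I x} (hY : IsSmoothNear I u Y)
    (hZ : IsSmoothNear I u Z) : IsSmoothNear I u (Y + Z) := by
  filter_upwards [hY, hZ] with x h1 h2 using h1.add_section h2

variable {I} in
theorem IsSmoothNear.smul {u : M} {Y : Π x : M, TangentSpace I x} (c : ℝ)
    (hY : IsSmoothNear I u Y) : IsSmoothNear I u (c • Y) := by
  filter_upwards [hY] with x h using h.const_smul_section

theorem isSmoothNear_zero (u : M) : IsSmoothNear I u 0 :=
  Eventually.of_forall fun x => Bundle.contMDiff_zeroSection ℝ (TangentSpace I : M → Type _) x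

/-- The vector fields that are smooth on some neighbourhood of `u`. -/
def smoothNear (u : M) : Submodule ℝ (Π x : M, TangentSpace I x) where
  carrier := {Y | IsSmoothNear I u Y}
  add_mem' hY hZ := IsSmoothNear.add hY hZ
  zero_mem' := isSmoothNear_zero I u
  smul_mem' c _ hY := IsSmoothNear.smul c hY

/-- The vector fields, smooth near `u`, that vanish identically on some neighbourhood of `u`. -/
def vanishNear (u : M) : Submodule ℝ (smoothNear I u) where
  carrier := {Y | ∀ᶠ x in 𝓝 u, (Y : Π x : M, TangentSpace I x) x = 0}
  add_mem' {Y Z} hY hZ := by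
    filter_upwards [hY, hZ] with x h1 h2
    simp [h1, h2]
  zero_mem' := Eventually.of_forall fun x => rfl
  smul_mem' c Y hY := by
    filter_upwards [hY] with x h
    simp [h]

/-- The germs at `u` of smooth vector fields. -/
abbrev VFGerm (u : M) : Type _ := smoothNear I u ⧸ vanishNear I u

variable {I}

theorem IsSmoothNear.lie [CompleteSpace F] {u : M} {Y Z : Π x : M, TangentSpace I x}
    (hY : IsSmoothNear I u Y) (hZ : IsSmoothNear I u Z) :
    IsSmoothNear I u (VectorField.mlieBracket I Y Z) := by
  have : IsManifold I ((⊤ : ℕ∞) + 1) M := inferInstanceAs (IsManifold I ∞ M)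
  have : IsManifold I (minSmoothness ℝ 2) M := by
    rw [minSmoothness_of_isRCLikeNormedField]; infer_instance
  filter_upwards [hY, hZ] with x h1 h2
  exact ContMDiffAt.mlieBracket_vectorField (m := ⊤) (n := ⊤) h1 h2 (by simp)

theorem IsSmoothNear.mdiff {u : M} {Y : Π x : M, TangentSpace I x} (hY : IsSmoothNear I u Y) :
    ∀ᶠ x in 𝓝 u,
      MDifferentiableAt I I.tangent (fun y => (⟨y, Y y⟩ : TangentBundle I M)) x := by
  filter_upwards [hY] with x h using h.mdifferentiableAt (by simp)

/-- The germ at `u` of a vector field that is smooth near `u`. -/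
def VFGerm.mk {u : M} (Y : Π x : M, TangentSpace I x) (hY : IsSmoothNear I u Y) : VFGerm I u :=
  Submodule.Quotient.mk ⟨Y, hY⟩

theorem VFGerm.mk_eq_mk {u : M} {Y Z : Π x : M, TangentSpace I x} {hY : IsSmoothNear I u Y}
    {hZ : IsSmoothNear I u Z} : VFGerm.mk Y hY = VFGerm.mk Z hZ ↔ Y =ᶠ[𝓝 u] Z := by
  rw [VFGerm.mk, VFGerm.mk, Submodule.Quotient.eq]
  show (∀ᶠ x in 𝓝 u, Y x - Z x = 0) ↔ _
  simp only [sub_eq_zero]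
  rfl

theorem VFGerm.exists_rep {u : M} (y : VFGerm I u) : 
    ∃ Y hY, y = VFGerm.mk (I := I) (u := u) Y hY := by
  obtain ⟨⟨Y, hY⟩, rfl⟩ := Submodule.Quotient.mk_surjective _ y
  exact ⟨Y, hY, rfl⟩

/-- The Lie bracket of germs of vector fields. -/
instance [CompleteSpace F] (u : M) : Bracket (VFGerm I u) (VFGerm I u) where
  bracket := Quotient.map₂
    (fun Y Z => ⟨VectorField.mlieBracket I Y.1 Z.1, IsSmoothNear.lie Y.2 Z.2⟩) (by
      intro Y Y' h Z Z' h'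
      have e1 := VFGerm.mk_eq_mk (hY := Y.2) (hZ := Y'.2) |>.1 (Quotient.sound h)
      have e2 := VFGerm.mk_eq_mk (hY := Z.2) (hZ := Z'.2) |>.1 (Quotient.sound h')
      exact Quotient.exact (VFGerm.mk_eq_mk (hY := IsSmoothNear.lie Y.2 Z.2)
        (hZ := IsSmoothNear.lie Y'.2 Z'.2) |>.2 (e1.mlieBracket_vectorField e2)))

theorem VFGerm.lie_mk [CompleteSpace F] {u : M} {Y Z : Π x : M, TangentSpace I x}
    (hY : IsSmoothNear I u Y) (hZ : IsSmoothNear I u Z) :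
    ⁅VFGerm.mk Y hY, VFGerm.mk Z hZ⁆ = VFGerm.mk (VectorField.mlieBracket I Y Z) (hY.lie hZ) := rfl

theorem VFGerm.add_mk {u : M} {Y Z : Π x : M, TangentSpace I x}
    (hY : IsSmoothNear I u Y) (hZ : IsSmoothNear I u Z) :
    VFGerm.mk Y hY + VFGerm.mk Z hZ = VFGerm.mk (Y + Z) (hY.add hZ) := rfl

theorem VFGerm.smul_mk {u : M} (c : ℝ) {Y : Π x : M, TangentSpace I x}
    (hY : IsSmoothNear I u Y) :
    c • VFGerm.mk Y hY = VFGerm.mk (c • Y) (hY.smul c) := rfl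

theorem VFGerm.zero_mk {u : M} :
    (0 : VFGerm I u) = VFGerm.mk 0 (isSmoothNear_zero I u) := rfl

instance [CompleteSpace F] (u : M) : LieRing (VFGerm I u) where
  add_lie y z w := by
    obtain ⟨Y, hY, rfl⟩ := y.exists_rep
    obtain ⟨Z, hZ, rfl⟩ := z.exists_rep
    obtain ⟨W, hW, rfl⟩ := w.exists_rep
    simp only [VFGerm.add_mk, VFGerm.lie_mk]
    refine VFGerm.mk_eq_mk.2 ?_
    filter_upwards [hY.mdiff, hZ.mdiff] with x h1 h2
    exact VectorField.mlieBracket_add_left h1 h2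
  lie_add y z w := by
    obtain ⟨Y, hY, rfl⟩ := y.exists_rep
    obtain ⟨Z, hZ, rfl⟩ := z.exists_rep
    obtain ⟨W, hW, rfl⟩ := w.exists_rep
    simp only [VFGerm.add_mk, VFGerm.lie_mk]
    refine VFGerm.mk_eq_mk.2 ?_
    filter_upwards [hZ.mdiff, hW.mdiff] with x h1 h2
    exact VectorField.mlieBracket_add_right h1 h2
  lie_self y := by
    obtain ⟨Y, hY, rfl⟩ := y.exists_rep
    rw [VFGerm.lie_mk, VFGerm.zero_mk]
    exact VFGerm.mk_eq_mk.2 (by rw [VectorField.mlieBracket_self]; exact EventuallyEq.rfl)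
  leibniz_lie y z w := by
    obtain ⟨Y, hY, rfl⟩ := y.exists_rep
    obtain ⟨Z, hZ, rfl⟩ := z.exists_rep
    obtain ⟨W, hW, rfl⟩ := w.exists_rep
    simp only [VFGerm.add_mk, VFGerm.lie_mk]
    refine VFGerm.mk_eq_mk.2 ?_
    have : IsManifold I (minSmoothness ℝ 3) M := by
      rw [minSmoothness_of_isRCLikeNormedField]; infer_instance
    filter_upwards [hY, hZ, hW] with x h1 h2 h3
    have hle : minSmoothness ℝ 2 ≤ ∞ := by
      rw [minSmoothness_of_isRCLikeNormedField]; exact ENat.LEInfty.out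
    exact VectorField.leibniz_identity_mlieBracket_apply (h1.of_le hle) (h2.of_le hle)
      (h3.of_le hle)

instance [CompleteSpace F] (u : M) : LieAlgebra ℝ (VFGerm I u) where
  lie_smul c y z := by
    obtain ⟨Y, hY, rfl⟩ := y.exists_rep
    obtain ⟨Z, hZ, rfl⟩ := z.exists_rep
    simp only [VFGerm.smul_mk, VFGerm.lie_mk]
    refine VFGerm.mk_eq_mk.2 ?_
    filter_upwards [hZ.mdiff] with x h1
    exact VectorField.mlieBracket_const_smul_right h1

end VectorFieldGerms

section CotangentBundle

/-- The cotangent bundle `T*N` of an `n`-dimensional manifold `N`. -/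
abbrev CotBundle (n : ℕ) (N : Type*) [TopologicalSpace N]
    [ChartedSpace (EuclideanSpace ℝ (Fin n)) N] [IsManifold (𝓡 n) ∞ N] : Type _ :=
  Bundle.TotalSpace (EuclideanSpace ℝ (Fin n) →L[ℝ] ℝ)
    (fun x : N => TangentSpace (𝓡 n) x →L[ℝ] Bundle.Trivial N ℝ x)

/-- The model with corners of the `2n`-dimensional manifold `T*N`. -/
abbrev cotModel (n : ℕ) : ModelWithCorners ℝ
    (EuclideanSpace ℝ (Fin n) × (EuclideanSpace ℝ (Fin n) →L[ℝ] ℝ))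
    (ModelProd (EuclideanSpace ℝ (Fin n)) (EuclideanSpace ℝ (Fin n) →L[ℝ] ℝ)) :=
  (𝓡 n).prod 𝓘(ℝ, EuclideanSpace ℝ (Fin n) →L[ℝ] ℝ)

variable {n : ℕ} {N : Type*} [TopologicalSpace N]
  [ChartedSpace (EuclideanSpace ℝ (Fin n)) N] [IsManifold (𝓡 n) ∞ N]

/-- The tautological 1-form `ϑ_β = β ∘ π_*` of `T*N`, i.e. `p_i dq^i`. -/
def tautForm (β : CotBundle n N) : TangentSpace (cotModel n) β →L[ℝ] ℝ :=
  ContinuousLinearMap.comp (show TangentSpace (𝓡 n) β.proj →L[ℝ] ℝ from β.snd)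
    (mfderiv (cotModel n) (𝓡 n) (Bundle.TotalSpace.proj : CotBundle n N → N) β)

/-- The expression of the 1-form `η` of `T*N` in the chart around `x`. -/
def formInChart (η : Π β : CotBundle n N, TangentSpace (cotModel n) β →L[ℝ] ℝ)
    (x : CotBundle n N) (z : EuclideanSpace ℝ (Fin n) × (EuclideanSpace ℝ (Fin n) →L[ℝ] ℝ)) :
    (EuclideanSpace ℝ (Fin n) × (EuclideanSpace ℝ (Fin n) →L[ℝ] ℝ)) →L[ℝ] ℝ :=
  ContinuousLinearMap.comp (η ((extChartAt (cotModel n) x).symm z))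
    (mfderiv 𝓘(ℝ, EuclideanSpace ℝ (Fin n) × (EuclideanSpace ℝ (Fin n) →L[ℝ] ℝ)) (cotModel n)
      (extChartAt (cotModel n) x).symm z)

/-- The canonical symplectic form `Ω = dϑ` of `T*N`; the exterior derivative at `x` is computed in
the chart around `x`, with `dη(v, w) = (D_v η)(w) - (D_w η)(v)`. -/
def sympForm (x : CotBundle n N) (v w : TangentSpace (cotModel n) x) : ℝ :=
  let φ := extChartAt (cotModel n) x
  let D := fderiv ℝ (formInChart tautForm x) (φ x)
  let v' := mfderiv (cotModel n)
    𝓘(ℝ, EuclideanSpace ℝ (Fin n) × (EuclideanSpace ℝ (Fin n) →L[ℝ] ℝ)) φ x v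
  let w' := mfderiv (cotModel n)
    𝓘(ℝ, EuclideanSpace ℝ (Fin n) × (EuclideanSpace ℝ (Fin n) →L[ℝ] ℝ)) φ x w
  D v' w' - D w' v'

/-- The differential `df|_x` of a real function on `T*N`. -/
def dform (f : CotBundle n N → ℝ) (x : CotBundle n N) : TangentSpace (cotModel n) x →L[ℝ] ℝ :=
  mfderiv (cotModel n) 𝓘(ℝ, ℝ) f x

/-- The value at `x` of
`(L_Y Ω)(V, W) = Y(Ω(V, W)) - Ω([Y, V], W) - Ω(V, [Y, W])`. -/
def lieDerivSympForm (Y V W : Π x : CotBundle n N, TangentSpace (cotModel n) x)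
    (x : CotBundle n N) : ℝ :=
  dform (fun y => sympForm y (V y) (W y)) x (Y x)
    - sympForm x (VectorField.mlieBracket (cotModel n) Y V x) (W x)
    - sympForm x (V x) (VectorField.mlieBracket (cotModel n) Y W x)

/-- `(L_Y Ω)|_x = 0` and `(ι_Y dH)|_x = 0`. -/
def IsSympSymmetryAt (H : CotBundle n N → ℝ)
    (Y : Π x : CotBundle n N, TangentSpace (cotModel n) x) (x : CotBundle n N) : Prop :=
  (∀ V W : Π x : CotBundle n N, TangentSpace (cotModel n) x,
    IsSmoothNear (cotModel n) x V → IsSmoothNear (cotModel n) x W →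
      lieDerivSympForm Y V W x = 0) ∧
  dform H x (Y x) = 0

/-- `𝔰𝔭^H`: the germs at `u` of `H`-symplectic symmetries, i.e. of vector fields `Y` with
`L_Y Ω = 0` and `ι_Y dH = 0`. -/
def spGerms (H : CotBundle n N → ℝ) (u : CotBundle n N) : Set (VFGerm (cotModel n) u) :=
  {y | ∃ Y hY, y = VFGerm.mk Y hY ∧ ∀ᶠ x in 𝓝 u, IsSympSymmetryAt H Y x}

/-- The velocity at time `t` of a curve defined on the set `s` of times. -/
def velocity (γ : ℝ → CotBundle n N) (s : Set ℝ) (t : ℝ) : TangentSpace (cotModel n) (γ t) :=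
  mfderivWithin 𝓘(ℝ, ℝ) (cotModel n) γ s t (1 : ℝ)

/-- The Poincaré-Cartan 1-form `α^H = ϑ - H dt` on `T*N × ℝ`. -/
def poincareCartan (H : CotBundle n N → ℝ) (e : CotBundle n N × ℝ)
    (v : TangentSpace (cotModel n) e.1 × ℝ) : ℝ :=
  tautForm e.1 v.1 - H e.1 * v.2

/-- The action `∫ α^H` along the section `t ↦ (γ t, t)` over `[a, b]`. -/
def hamAction (H : CotBundle n N → ℝ) (a b : ℝ) (γ : ℝ → CotBundle n N) : ℝ :=
  ∫ t in a..b, poincareCartan H (γ t, t) (velocity γ (Set.Icc a b) t, 1)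

/-- `F` is a smooth variation in `U`, with fixed end points and with parameter in `[-ε, ε]`, of the
restriction of `γ` to `[a, b]`. -/
structure IsVariation (U : Set (CotBundle n N)) (γ : ℝ → CotBundle n N) (a b ε : ℝ)
    (F : ℝ × ℝ → CotBundle n N) : Prop where
  smooth : ContMDiffOn 𝓘(ℝ, ℝ × ℝ) (cotModel n) ∞ F (Set.Icc a b ×ˢ Set.Icc (-ε) ε)
  mapsTo : Set.MapsTo F (Set.Icc a b ×ˢ Set.Icc (-ε) ε) U
  zero : ∀ t ∈ Set.Icc a b, F (t, 0) = γ t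
  left : ∀ s ∈ Set.Icc (-ε) ε, F (a, s) = γ a
  right : ∀ s ∈ Set.Icc (-ε) ε, F (b, s) = γ b

/-- The smooth curve `γ : T → U`, on the open interval `T` of times, satisfies the variational
principle of the action of `H : U → ℝ`. -/
structure IsMotion (H : CotBundle n N → ℝ) (U : Set (CotBundle n N)) (T : Set ℝ)
    (γ : ℝ → CotBundle n N) : Prop where
  isOpen : IsOpen T
  ordConnected : T.OrdConnected
  smooth : ContMDiffOn 𝓘(ℝ, ℝ) (cotModel n) ∞ γ T
  mapsTo : Set.MapsTo γ T U
  stationary : ∀ a b ε : ℝ, a < b → Set.Icc a b ⊆ T → 0 < ε →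
    ∀ F : ℝ × ℝ → CotBundle n N, IsVariation U γ a b ε F →
      HasDerivAt (fun s => hamAction H a b (fun t => F (t, s))) 0 0

/-- The function `f : V → ℝ` is a first integral of elementary type for `H : U → ℝ`, i.e. a smooth
function of the phase space coordinates only, which is constant along the motions. -/
structure IsFirstIntegral (H : CotBundle n N → ℝ) (U V : Set (CotBundle n N))
    (f : CotBundle n N → ℝ) : Prop where
  smooth : ContMDiffOn (cotModel n) 𝓘(ℝ, ℝ) ∞ f V
  const : ∀ T γ, IsMotion H U T γ → ∀ t ∈ T, γ t ∈ V → HasDerivAt (fun s => f (γ s)) 0 t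

/-- The germs at `u` of first integrals of elementary type for `H : U → ℝ`. -/
def elemGerms (H : CotBundle n N → ℝ) (U : Set (CotBundle n N)) (u : CotBundle n N) :
    Set (Germ (𝓝 u) ℝ) :=
  {f | ∃ (V : Set (CotBundle n N)) (f₀ : CotBundle n N → ℝ), IsOpen V ∧ u ∈ V ∧ V ⊆ U ∧
    IsFirstIntegral H U V f₀ ∧ f = (f₀ : Germ (𝓝 u) ℝ)}

/-- The germ `y` is the germ of the Hamiltonian vector field of `f`: `ι_Y Ω = df` near `u`. -/
def IsHamGerm {u : CotBundle n N} (f : Germ (𝓝 u) ℝ) (y : VFGerm (cotModel n) u) : Prop :=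
  ∃ (f₀ : CotBundle n N → ℝ) (Y : Π x : CotBundle n N, TangentSpace (cotModel n) x)
    (hY : IsSmoothNear (cotModel n) u Y), f = (f₀ : Germ (𝓝 u) ℝ) ∧ y = VFGerm.mk Y hY ∧
      ∀ᶠ x in 𝓝 u, ∀ w : TangentSpace (cotModel n) x, sympForm x (Y x) w = dform f₀ x w

/-- The Hamiltonian vector field of `f` at `x`: the vector `v`, unique since `Ω` is
non-degenerate, with `ι_v Ω = df|_x`. -/
def hamField (f : CotBundle n N → ℝ) (x : CotBundle n N) : TangentSpace (cotModel n) x :=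
  Classical.epsilon fun v => ∀ w, sympForm x v w = dform f x w

/-- The Poisson bracket `{f, g} = dg(Y_f)`, i.e. `∂f/∂q^i ∂g/∂p_i - ∂f/∂p_i ∂g/∂q^i`. -/
def poisson (f g : CotBundle n N → ℝ) (x : CotBundle n N) : ℝ :=
  dform g x (hamField f x)

theorem poisson_congr {u : CotBundle n N} {f f' g g' : CotBundle n N → ℝ} (hf : f =ᶠ[𝓝 u] f')
    (hg : g =ᶠ[𝓝 u] g') : poisson f g =ᶠ[𝓝 u] poisson f' g' := by
  filter_upwards [hf.eventuallyEq_nhds, hg.eventuallyEq_nhds] with x h1 h2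
  have e1 : dform f x = dform f' x := h1.mfderiv_eq
  have e2 : dform g x = dform g' x := h2.mfderiv_eq
  simp only [poisson, hamField, e1, e2]

/-- The Poisson bracket of germs of functions. -/
def poissonGerm {u : CotBundle n N} (f g : Germ (𝓝 u) ℝ) : Germ (𝓝 u) ℝ :=
  Quotient.map₂ poisson (fun _ _ hf _ _ hg => poisson_congr hf hg) f g

/-- The germs at `u` in the collection `A` are first integrals of elementary type for `H : U → ℝ`
which constitute, by means of Poisson brackets, the Lie algebra `𝔤 ⊆ 𝔰𝔭^H`: modulo constants they
correspond to the elements of `𝔤` under `ι_Y Ω = df`, and the Lie bracket of `𝔤` is the Poisson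
bracket, modulo constants. -/
structure Constitutes (H : CotBundle n N → ℝ) (U : Set (CotBundle n N)) (u : CotBundle n N)
    (A : Set (Germ (𝓝 u) ℝ)) (𝔤 : LieSubalgebra ℝ (VFGerm (cotModel n) u)) : Prop where
  firstIntegral : A ⊆ elemGerms H U u
  subset_sp : (𝔤 : Set (VFGerm (cotModel n) u)) ⊆ spGerms H u
  exists_ham : ∀ f ∈ A, ∃ y ∈ 𝔤, IsHamGerm f y
  exists_integral : ∀ y ∈ 𝔤, ∃ f ∈ A, IsHamGerm f y
  poisson : ∀ f ∈ A, ∀ g ∈ A, ∀ y ∈ 𝔤, ∀ z ∈ 𝔤, IsHamGerm f y → IsHamGerm g z →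
    ∃ h ∈ A, IsHamGerm h ⁅y, z⁆ ∧ ∃ c : ℝ, h = poissonGerm f g + Germ.const c

end CotangentBundle

end HamSym

end

namespace HamSym

-- The theorem rests on a local normal form: near a regular point, a Hamiltonian has no local
-- invariant under symplectomorphisms except its value. So `H` near `u` and `H'` near `u'` are
-- intertwined, up to an additive constant, by a germ of symplectomorphism
-- (`exists_cot_symplectomorphism`). Its push-forward carries `𝔤` and `A` to `H'`, because Lie
-- brackets, `Ω`, Hamiltonian vector fields and Poisson brackets are natural and the constant
-- disappears from `dH` (`Constitutes.push`).
--
-- For the normal form, charts of `T*N` already bring `Ω` to the constant form `dp ∧ dq`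
-- (`sympForm_eq`), so only `H` has to be straightened, on a vector space
-- (`exists_symplectic_straightening`). Choose `v` with `dH(v) ≠ 0` and `w` with `Ω(w, v) = 1`.
-- Flowing the hyperplane `z₀ + ker Ω(·, v)` along the Hamiltonian field of `H` gives a map `K`; an
-- explicit shear `G` along `v` satisfies `G^*Ω = K^*Ω`. Hence `K ∘ G⁻¹` is symplectic, and it turns
-- `H` into `H z₀ + Ω(w, ·)`. Two Hamiltonians straightened with the same `v` and `w` are conjugate
-- up to a constant.
--
-- The smooth local flow comes from the inverse function theorem on the Banach space of paths
-- `C([0,1], E)` (`exists_smooth_flow`).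
--
-- Motions are never transported. That the pushed functions are first integrals of `H'` is proved
-- afresh, by a Noether argument (`isFirstIntegral_of_hamiltonian`): if `ι_Y Ω = df` and `dH(Y) =
-- 0`, vary a motion along a bump function times `Y`; the first variation of the action is the
-- integral of the bump times `d/dt f(γ)`, so stationarity makes this derivative vanish.

universe u

/-! ### Smoothness of superposition operators on continuous maps -/

section Superposition

variable {K : Type*} [TopologicalSpace K] [CompactSpace K]

/-- Pointwise application of a continuous family of operators to a continuous family of vectors. -/
noncomputable def pointwiseApply (K : Type*) [TopologicalSpace K] [CompactSpace K]
    (E F : Type*) [NormedAddCommGroup E] [NormedSpace ℝ E] [NormedAddCommGroup F]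
    [NormedSpace ℝ F] : C(K, E →L[ℝ] F) →L[ℝ] C(K, E) →L[ℝ] C(K, F) :=
  LinearMap.mkContinuous₂
    (LinearMap.mk₂ ℝ (fun (A : C(K, E →L[ℝ] F)) (h : C(K, E)) =>
        (⟨fun s => A s (h s), by fun_prop⟩ : C(K, F)))
      (fun _ _ _ => by ext; simp) (fun _ _ _ => by ext; simp) (fun _ _ _ => by ext; simp)
      (fun _ _ _ => by ext; simp)) 1 (by
    intro A h
    rw [ContinuousMap.norm_le _ (by positivity)]
    intro s
    calc ‖A s (h s)‖ ≤ ‖A s‖ * ‖h s‖ := (A s).le_opNorm _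
      _ ≤ 1 * ‖A‖ * ‖h‖ := by
        rw [one_mul]
        gcongr
        exacts [A.norm_coe_le_norm s, h.norm_coe_le_norm s])

@[simp]
theorem pointwiseApply_apply {E F : Type*} [NormedAddCommGroup E] [NormedSpace ℝ E]
    [NormedAddCommGroup F] [NormedSpace ℝ F] (A : C(K, E →L[ℝ] F)) (h : C(K, E)) (s : K) :
    pointwiseApply K E F A h s = A s (h s) := rfl

/-- The superposition operator `γ ↦ X ∘ γ`. -/
def superpose (K : Type*) [TopologicalSpace K] {E F : Type*} [TopologicalSpace E]
    [TopologicalSpace F] (X : C(E, F)) (γ : C(K, E)) : C(K, F) := X.comp γ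

@[simp]
theorem superpose_apply {K : Type*} [TopologicalSpace K] {E F : Type*} [TopologicalSpace E]
    [TopologicalSpace F] (X : C(E, F)) (γ : C(K, E)) (s : K) :
    superpose K X γ s = X (γ s) := rfl

/-- The mean value inequality at each `s` needs one radius valid for all `s`. It comes from the
continuity of `γ ↦ X' ∘ γ` in the sup norm, that is from compactness of `K`; `E` need not be locally
compact. -/
theorem hasFDerivAt_superpose {E F : Type*} [NormedAddCommGroup E] [NormedSpace ℝ E]
    [NormedAddCommGroup F] [NormedSpace ℝ F] (X : C(E, F)) (X' : C(E, E →L[ℝ] F))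
    (hX : ∀ x, HasFDerivAt X (X' x) x) (γ : C(K, E)) :
    HasFDerivAt (superpose K X) (pointwiseApply K E F (superpose K X' γ)) γ := by
  rw [hasFDerivAt_iff_isLittleO_nhds_zero, Asymptotics.isLittleO_iff]
  intro ε hε
  have hc : Continuous (superpose K X') := ContinuousMap.continuous_postcomp X'
  obtain ⟨δ, hδ, hball⟩ := (Metric.continuousAt_iff (f := superpose K X') (a := γ)).1
    hc.continuousAt ε hε
  filter_upwards [Metric.ball_mem_nhds (0 : C(K, E)) hδ] with h hh
  rw [ContinuousMap.norm_le _ (by positivity)]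
  intro s
  have hs : ‖h s‖ ≤ ‖h‖ := h.norm_coe_le_norm s
  have hh' : ‖h‖ < δ := by simpa using hh
  have key := (convex_ball (γ s) δ).norm_image_sub_le_of_norm_hasFDerivWithin_le'
    (f := X) (f' := X') (φ := X' (γ s)) (C := ε) (x := γ s) (y := γ s + h s)
    (fun x _ => (hX x).hasFDerivWithinAt) (by
      intro y hy
      have h1 : dist (γ + ContinuousMap.const K (y - γ s)) γ < δ := by
        rw [dist_eq_norm, add_sub_cancel_left]
        refine lt_of_le_of_lt ((ContinuousMap.norm_le _ (norm_nonneg (y - γ s))).2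
          fun _ => le_rfl) ?_
        simpa [dist_eq_norm] using hy
      have h2 := (ContinuousMap.dist_lt_iff hε).1 (hball h1) s
      simpa [dist_eq_norm] using h2.le)
    (Metric.mem_ball_self hδ) (by simpa using hs.trans_lt hh')
  simp only [add_sub_cancel_left] at key
  exact key.trans (by gcongr)

/-- The derivative is again a superposition operator, that of `fderiv ℝ X`, followed by a continuous
linear map, so induction on `k` applies. The target changes from `F` to `E →L[ℝ] F`, hence the
quantifier over `F` and the common universe. -/
theorem contDiff_superpose_nat {E : Type u} [NormedAddCommGroup E] [NormedSpace ℝ E] (k : ℕ) :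
    ∀ {F : Type u} [NormedAddCommGroup F] [NormedSpace ℝ F] (X : C(E, F)), ContDiff ℝ k X →
      ContDiff ℝ k (superpose K X) := by
  induction k with
  | zero =>
    intro F _ _ X _
    exact contDiff_zero.2 (ContinuousMap.continuous_postcomp X)
  | succ k ih =>
    intro F _ _ X hX
    rw [Nat.cast_add, Nat.cast_one, contDiff_succ_iff_hasFDerivAt]
    have hX' : ContDiff ℝ k (fderiv ℝ X) := hX.fderiv_right (by norm_cast)
    have hL : ContDiff ℝ k (fun A => pointwiseApply K E F A) := by
      fun_prop
    refine ⟨fun γ => pointwiseApply K E F (superpose K ⟨fderiv ℝ X, hX'.continuous⟩ γ),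
      hL.comp (ih ⟨fderiv ℝ X, hX'.continuous⟩ hX'), fun γ =>
      hasFDerivAt_superpose X ⟨fderiv ℝ X, hX'.continuous⟩ (fun x => ?_) γ⟩
    exact (hX.differentiable (by norm_cast) x).hasFDerivAt

theorem contDiff_superpose {E F : Type u} [NormedAddCommGroup E] [NormedSpace ℝ E]
    [NormedAddCommGroup F] [NormedSpace ℝ F] (X : C(E, F)) (hX : ContDiff ℝ ∞ X) :
    ContDiff ℝ ∞ (superpose K X) :=
  contDiff_infty.2 fun k => contDiff_superpose_nat k X (hX.of_le (by exact_mod_cast le_top))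

end Superposition

/-! ### Inverse function theorem with a smooth inverse on an open set -/

section InverseFunction

variable {E F : Type*} [NormedAddCommGroup E] [NormedSpace ℝ E] [CompleteSpace E]
  [NormedAddCommGroup F] [NormedSpace ℝ F]

/-- The inverse is smooth wherever the derivative is invertible. Invertible operators form an open
set and `fderiv ℝ f` is continuous at `a`, so shrinking the source makes the inverse smooth on the
whole target. -/
theorem exists_smooth_openPartialHomeomorph {f : E → F} {a : E}
    (hf : ∀ᶠ x in 𝓝 a, ContDiffAt ℝ ∞ f x) (f' : E ≃L[ℝ] F)
    (hf' : HasFDerivAt f (f' : E →L[ℝ] F) a) :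
    ∃ e : OpenPartialHomeomorph E F, a ∈ e.source ∧ (e : E → F) = f ∧
      (∀ x ∈ e.source, ContDiffAt ℝ ∞ f x) ∧ ∀ y ∈ e.target, ContDiffAt ℝ ∞ e.symm y := by
  have hfa : ContDiffAt ℝ ∞ f a := hf.self_of_nhds
  let e₀ := hfa.toOpenPartialHomeomorph f hf' (by simp)
  have hcont : ContinuousAt (fderiv ℝ f) a := hfa.continuousAt_fderiv (by simp)
  have hinv : ∀ᶠ x in 𝓝 a, fderiv ℝ f x ∈ Set.range ((↑) : (E ≃L[ℝ] F) → E →L[ℝ] F) := by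
    refine hcont.eventually (ContinuousLinearEquiv.isOpen.mem_nhds ?_)
    rw [hf'.fderiv]
    exact ⟨f', rfl⟩
  obtain ⟨O, hO, hOo, haO⟩ := eventually_nhds_iff.1 (hf.and hinv)
  refine ⟨e₀.restrOpen O hOo, ?_, rfl, ?_, ?_⟩
  · rw [OpenPartialHomeomorph.restrOpen_source]
    exact ⟨hfa.mem_toOpenPartialHomeomorph_source hf' (by simp), haO⟩
  · intro x hx
    rw [OpenPartialHomeomorph.restrOpen_source] at hx
    exact (hO x hx.2).1
  · intro y hy
    have hx := (e₀.restrOpen O hOo).map_target hy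
    rw [OpenPartialHomeomorph.restrOpen_source] at hx
    obtain ⟨h1, g, hg⟩ := hO _ hx.2
    refine (e₀.restrOpen O hOo).contDiffAt_symm (f₀' := g) hy ?_ h1
    rw [hg]
    exact (h1.differentiableAt (by simp)).hasFDerivAt

end InverseFunction

/-! ### Smooth local flows through the Banach space of paths -/

section Flow

variable {E : Type u} [NormedAddCommGroup E] [NormedSpace ℝ E]

/-- The continuous linear inclusion of the constant paths. -/
noncomputable def constPath (E : Type*) [NormedAddCommGroup E] [NormedSpace ℝ E] :
    E →L[ℝ] C(unitInterval, E) :=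
  LinearMap.mkContinuous
    { toFun := ContinuousMap.const unitInterval
      map_add' := fun _ _ => rfl
      map_smul' := fun _ _ => rfl } 1 (by
    intro x
    rw [ContinuousMap.norm_le _ (by positivity)]
    intro s
    rw [one_mul]
    exact le_rfl)

@[simp]
theorem constPath_apply (x : E) (s : unitInterval) : constPath E x s = x := rfl

theorem continuous_projIcc_comp {E : Type*} [TopologicalSpace E] (γ : C(unitInterval, E)) :
    Continuous fun r : ℝ => γ (Set.projIcc 0 1 zero_le_one r) :=
  γ.continuous.comp continuous_projIcc

/-- The primitive, vanishing at `0`, of a path. -/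
noncomputable def primitivePath (E : Type*) [NormedAddCommGroup E] [NormedSpace ℝ E] :
    C(unitInterval, E) →L[ℝ] C(unitInterval, E) :=
  LinearMap.mkContinuous
    { toFun := fun γ => 
        { toFun := fun s => ∫ r in (0 : ℝ)..s, γ (Set.projIcc 0 1 zero_le_one r)
          continuous_toFun := (intervalIntegral.continuous_primitive
            (fun a b => (continuous_projIcc_comp γ).intervalIntegrable a b) 0).comp
              continuous_subtype_val }
      map_add' := fun γ δ => by
        ext s
        exact intervalIntegral.integral_add ((continuous_projIcc_comp γ).intervalIntegrable _ _)
          ((continuous_projIcc_comp δ).intervalIntegrable _ _)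
      map_smul' := fun c γ => by
        ext s
        exact intervalIntegral.integral_smul c _ } 1 (by
    intro γ
    rw [ContinuousMap.norm_le _ (by positivity)]
    intro s
    refine (intervalIntegral.norm_integral_le_of_norm_le_const (C := ‖γ‖)
      fun r _ => γ.norm_coe_le_norm _).trans ?_
    rw [sub_zero, abs_of_nonneg s.2.1, one_mul]
    exact mul_le_of_le_one_right (norm_nonneg _) s.2.2)

theorem primitivePath_apply (γ : C(unitInterval, E)) (s : unitInterval) :
    primitivePath E γ s = ∫ r in (0 : ℝ)..s, γ (Set.projIcc 0 1 zero_le_one r) := rfl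

/-- The path `r ↦ γ (s r)`. -/
def scalePath {E : Type*} [TopologicalSpace E] (s : unitInterval) (γ : C(unitInterval, E)) :
    C(unitInterval, E) :=
  γ.comp ⟨fun r => s * r, by fun_prop⟩

@[simp]
theorem scalePath_apply {E : Type*} [TopologicalSpace E] (s : unitInterval) (γ : C(unitInterval, E))
    (r : unitInterval) :
    scalePath s γ r = γ (s * r) := rfl

theorem smul_primitivePath_scalePath (s : unitInterval) (γ : C(unitInterval, E)) :
    (s : ℝ) • primitivePath E (scalePath s γ) = scalePath s (primitivePath E γ) := by
  ext r
  simp only [ContinuousMap.smul_apply, primitivePath_apply, scalePath_apply, Set.Icc.coe_mul]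
  have h := intervalIntegral.smul_integral_comp_mul_left (a := 0) (b := (r : ℝ))
    (fun x => γ (Set.projIcc 0 1 zero_le_one x)) (s : ℝ)
  rw [mul_zero] at h
  rw [← h]
  congr 1
  refine intervalIntegral.integral_congr fun x hx => ?_
  rw [Set.uIcc_of_le r.2.1] at hx
  have hx' : x ∈ Set.Icc (0 : ℝ) 1 := ⟨hx.1, hx.2.trans r.2.2⟩
  have hsx : (s : ℝ) * x ∈ Set.Icc (0 : ℝ) 1 := (s * ⟨x, hx'⟩ : unitInterval).2
  rw [Set.projIcc_of_mem _ hx', Set.projIcc_of_mem _ hsx]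
  rfl

/-- `γ - x - ε ∫ X ∘ γ`, whose zeros are the integral curves of `ε X` starting at `x`. -/
noncomputable def pathDefect (X : C(E, E)) (q : (ℝ × E) × C(unitInterval, E)) :
    C(unitInterval, E) :=
  q.2 - constPath E q.1.2 - q.1.1 • primitivePath E (superpose unitInterval X q.2)

theorem contDiff_pathDefect (X : C(E, E)) (hX : ContDiff ℝ ∞ X) :
    ContDiff ℝ ∞ (pathDefect X) := by
  have h1 : ContDiff ℝ ∞ (superpose unitInterval X) := contDiff_superpose X hX
  have h2 : ContDiff ℝ ∞ (constPath E) := by fun_prop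
  have h3 : ContDiff ℝ ∞ (primitivePath E) := by fun_prop
  unfold pathDefect
  fun_prop

/-- Running an integral curve of `ε X` at speed `s` gives an integral curve of `s ε X`. This links
the solutions for different `ε`, and so makes `ε` play the part of time. -/
theorem scalePath_pathDefect (X : C(E, E)) (s : unitInterval) (ε : ℝ) (x : E)
    (γ : C(unitInterval, E)) :
    pathDefect X ((s * ε, x), scalePath s γ) = scalePath s (pathDefect X ((ε, x), γ)) := by
  have h1 : superpose unitInterval X (scalePath s γ) = scalePath s (superpose unitInterval X γ) :=
    rfl
  unfold pathDefect
  simp only [h1]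
  rw [mul_comm, mul_smul, smul_primitivePath_scalePath]
  rfl

/-- At `ε = 0` the factor `ε` kills the derivative of `∫ X ∘ γ` in `γ`, so the partial derivative in
the path is the identity and the full derivative is triangular, hence invertible. -/
theorem hasFDerivAt_pathDefect_zero (X : C(E, E)) (hX : ContDiff ℝ ∞ X) (x₀ : E) :
    HasFDerivAt (fun q : (ℝ × E) × C(unitInterval, E) => (q.1, pathDefect X q))
      (((ContinuousLinearEquiv.refl ℝ (ℝ × E)).skewProd
        (ContinuousLinearEquiv.refl ℝ C(unitInterval, E))
        (-((constPath E).comp (ContinuousLinearMap.snd ℝ ℝ E) +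
          (ContinuousLinearMap.fst ℝ ℝ E).smulRight
            (primitivePath E (superpose unitInterval X (constPath E x₀))))) :
        ((ℝ × E) × C(unitInterval, E)) ≃L[ℝ] ((ℝ × E) × C(unitInterval, E))) :
        ((ℝ × E) × C(unitInterval, E)) →L[ℝ] ((ℝ × E) × C(unitInterval, E)))
      ((0, x₀), constPath E x₀) := by
  have h1 : ContDiff ℝ ∞ (fun q : (ℝ × E) × C(unitInterval, E) =>
      primitivePath E (superpose unitInterval X q.2)) := by
    have h1 : ContDiff ℝ ∞ (superpose unitInterval X) := contDiff_superpose X hX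
    have h3 : ContDiff ℝ ∞ (primitivePath E) := by fun_prop
    fun_prop
  have h2 := (h1.differentiable (by simp) ((0, x₀), constPath E x₀)).hasFDerivAt
  have h3 : HasFDerivAt (fun q : (ℝ × E) × C(unitInterval, E) => q.1.1) _
    ((0, x₀), constPath E x₀) := (hasFDerivAt_fst (𝕜 := ℝ)).fst
  have h4 : HasFDerivAt (fun q : (ℝ × E) × C(unitInterval, E) => q.1.2) _
    ((0, x₀), constPath E x₀) := (hasFDerivAt_fst (𝕜 := ℝ)).snd
  have h5 : HasFDerivAt (fun x => constPath E x) (constPath E) x₀ := by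
    apply ContinuousLinearMap.hasFDerivAt
  have h6 := h5.comp (f := fun q : (ℝ × E) × C(unitInterval, E) => q.1.2)
    ((0, x₀), constPath E x₀) h4
  have h := (hasFDerivAt_fst (𝕜 := ℝ)).prodMk (((hasFDerivAt_snd (𝕜 := ℝ)).sub h6).sub (h3.smul h2))
  refine h.congr_fderiv ?_
  refine ContinuousLinearMap.ext fun q => Prod.ext (by simp) ?_
  simp only [sub_eq_add_neg]
  simp [add_assoc, add_comm]

/-- Solving `pathDefect = 0` for the path `Γ (ε, x)` gives a solution smooth in `(ε, x)`; the flow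
is its end point, `φ (t, x) = Γ (t, x) 1`. -/
theorem exists_smooth_flow [CompleteSpace E] (X : E → E) (hX : ContDiff ℝ ∞ X) (x₀ : E) :
    ∃ φ : ℝ × E → E, (∀ᶠ p in 𝓝 (0, x₀), ContDiffAt ℝ ∞ φ p) ∧
      (∀ᶠ p in 𝓝 (0, x₀), HasDerivAt (fun t => φ (t, p.2)) (X (φ p)) p.1) ∧
      ∀ᶠ x in 𝓝 x₀, φ (0, x) = x := by
  let Xc : C(E, E) := ⟨X, hX.continuous⟩
  obtain ⟨e, hmem, hcoe, -, hsymm⟩ := exists_smooth_openPartialHomeomorph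
    (Eventually.of_forall fun q => (contDiff_fst.prodMk (contDiff_pathDefect Xc hX)).contDiffAt)
    _ (hasFDerivAt_pathDefect_zero Xc hX x₀)
  have hval : ∀ q, e q = (q.1, pathDefect Xc q) := fun q => congrFun hcoe q
  have h0 : e ((0, x₀), constPath E x₀) = ((0, x₀), 0) := by
    rw [hval]; simp [pathDefect]
  let Γ : ℝ × E → C(unitInterval, E) := fun p => (e.symm (p, 0)).2
  have htgt : ∀ᶠ p in 𝓝 ((0 : ℝ), x₀), (p, (0 : C(unitInterval, E))) ∈ e.target := by
    have hc : Continuous fun p : ℝ × E => (p, (0 : C(unitInterval, E))) := by fun_prop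
    exact hc.continuousAt.eventually (e.open_target.mem_nhds (by
      simpa [h0] using e.map_source hmem))
  have hΓ : ∀ᶠ p in 𝓝 ((0 : ℝ), x₀), ContDiffAt ℝ ∞ Γ p := by
    filter_upwards [htgt] with p hp
    exact contDiffAt_snd.comp p ((hsymm _ hp).comp p (contDiffAt_id.prodMk contDiffAt_const))
  have hΓ0 : Γ (0, x₀) = constPath E x₀ := by
    simp only [Γ, ← h0, e.left_inv hmem]
  have hsol : ∀ᶠ p in 𝓝 ((0 : ℝ), x₀), pathDefect Xc (p, Γ p) = 0 := by
    filter_upwards [htgt] with p hp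
    have h1 := e.right_inv hp
    rw [hval] at h1
    have h2 := congrArg Prod.fst h1
    have h3 := congrArg Prod.snd h1
    simp only at h2 h3
    rw [show (p, Γ p) = e.symm (p, 0) from Prod.ext h2.symm rfl]
    exact h3
  obtain ⟨ρ, hρ, hball⟩ := Metric.isOpen_iff.1 e.open_source _ hmem
  have hsmall : ∀ᶠ p in 𝓝 ((0 : ℝ), x₀), dist p (0, x₀) < ρ ∧ dist (Γ p) (constPath E x₀) < ρ := by
    refine Eventually.and (Metric.ball_mem_nhds _ hρ) ?_
    exact hΓ.self_of_nhds.continuousAt.eventually (by rw [hΓ0]; exact Metric.ball_mem_nhds _ hρ)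
  -- Local uniqueness: for `s ∈ [0, 1]` rescaling does not increase the distance to the base point,
  -- so the rescaled path stays in `e.source`, where `e` is injective.
  have hscale : ∀ᶠ p in 𝓝 ((0 : ℝ), x₀), ∀ s : unitInterval,
      Γ (s * p.1, p.2) = scalePath s (Γ p) := by
    filter_upwards [hsol, hsmall] with p hp hp' s
    have hsrc : ((s * p.1, p.2), scalePath s (Γ p)) ∈ e.source := by
      refine hball ?_
      rw [Metric.mem_ball, Prod.dist_eq, max_lt_iff, Prod.dist_eq, max_lt_iff]
      have h1 := hp'.1
      rw [Prod.dist_eq, max_lt_iff] at h1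
      refine ⟨⟨lt_of_le_of_lt ?_ h1.1, h1.2⟩, ?_⟩
      · simp only [dist_zero_right, norm_mul, Real.norm_eq_abs, abs_of_nonneg s.2.1]
        exact mul_le_of_le_one_left (abs_nonneg _) s.2.2
      · refine (ContinuousMap.dist_lt_iff hρ).2 fun r => ?_
        exact (ContinuousMap.dist_lt_iff hρ).1 hp'.2 (s * r)
    have h2 : e ((s * p.1, p.2), scalePath s (Γ p)) = ((s * p.1, p.2), 0) := by
      rw [hval, scalePath_pathDefect, hp]
      rfl
    simp only [Γ, ← h2, e.left_inv hsrc]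
  let φ : ℝ × E → E := fun p => Γ p 1
  have hφ : ∀ᶠ p in 𝓝 ((0 : ℝ), x₀), ContDiffAt ℝ ∞ φ p := by
    filter_upwards [hΓ] with p hp
    have : ContDiff ℝ ∞ (ContinuousMap.evalCLM ℝ (1 : unitInterval) : C(unitInterval, E) → E) := by
      fun_prop
    exact this.contDiffAt.comp p hp
  have hpartial : ∀ p, ContDiffAt ℝ ∞ φ p →
      HasDerivAt (fun t => φ (t, p.2)) (fderiv ℝ φ p (1, 0)) p.1 := by
    intro p hp
    have h1 := (hp.differentiableAt (by simp)).hasFDerivAt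
    exact h1.comp_hasDerivAt (f := fun t => (t, p.2)) p.1
      ((hasDerivAt_id p.1).prodMk (hasDerivAt_const p.1 p.2))
  -- Differentiate `s ↦ φ (s t, x)` at `s = 1` in two ways, by the chain rule and from the integral
  -- equation; the common factor `t = p.1` must be cancelled.
  have hode : ∀ᶠ p in 𝓝 ((0 : ℝ), x₀), p.1 ≠ 0 → fderiv ℝ φ p (1, 0) = X (φ p) := by
    filter_upwards [hscale, hsol, hφ] with p hs hp hd hne
    have hcont := continuous_projIcc_comp (superpose unitInterval Xc (Γ p))
    have h1 : HasDerivAt (fun s : ℝ => p.2 + p.1 • ∫ r in (0 : ℝ)..s,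
        superpose unitInterval Xc (Γ p) (Set.projIcc 0 1 zero_le_one r)) (p.1 • X (φ p)) 1 := by
      have h2 := intervalIntegral.integral_hasDerivAt_right (hcont.intervalIntegrable 0 1)
        (hcont.stronglyMeasurableAtFilter _ _) hcont.continuousAt
      have h3 := (h2.const_smul p.1).const_add p.2
      rw [Set.projIcc_right] at h3
      exact h3
    have h2 : HasDerivAt (fun s : ℝ => φ (s * p.1, p.2)) (p.1 • fderiv ℝ φ p (1, 0)) 1 := by
      have h3 := hpartial p hd
      rw [← one_mul p.1] at h3
      have h4 := h3.scomp (1 : ℝ) ((hasDerivAt_id (1 : ℝ)).mul_const p.1)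
      simpa [Function.comp_def] using h4
    -- Scaling is known only for `s ∈ [0, 1]`; a one-sided derivative at `1` suffices, as the
    -- two-sided one exists by `h2`.
    have h3 : HasDerivWithinAt (fun s : ℝ => φ (s * p.1, p.2)) (p.1 • X (φ p))
        (Set.Icc 0 1) 1 := by
      refine h1.hasDerivWithinAt.congr_of_mem (fun s hs' => ?_) ⟨zero_le_one, le_rfl⟩
      have h4 := hs ⟨s, hs'⟩
      have h5 := congrArg (fun γ : C(unitInterval, E) => γ 1) h4
      have h6 := congrArg (fun γ : C(unitInterval, E) => γ ⟨s, hs'⟩) hp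
      simp only [scalePath_apply, mul_one] at h5
      simp only [pathDefect, ContinuousMap.sub_apply, ContinuousMap.smul_apply, constPath_apply,
        primitivePath_apply, ContinuousMap.zero_apply] at h6
      show Γ (s * p.1, p.2) 1 = _
      rw [h5, sub_sub, sub_eq_zero] at *
      exact h6
    have h4 := (uniqueDiffOn_Icc zero_lt_one 1 ⟨zero_le_one, le_rfl⟩).eq_deriv _
      h2.hasDerivWithinAt h3
    exact smul_right_injective E hne h4
  refine ⟨φ, hφ, ?_, ?_⟩
  · filter_upwards [hode.eventually_nhds, hφ] with p hp hd
    suffices fderiv ℝ φ p (1, 0) = X (φ p) from this ▸ hpartial p hd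
    -- At time `0` the equation follows by continuity of both sides, as the limit from nonzero
    -- times.
    by_cases hne : p.1 = 0
    · have hc : Tendsto (fun t : ℝ => (t, p.2)) (𝓝[≠] p.1) (𝓝 p) :=
        (Continuous.prodMk_left p.2).continuousAt.tendsto.mono_left nhdsWithin_le_nhds
      have h1 : Tendsto (fun t : ℝ => fderiv ℝ φ (t, p.2) (1, 0)) (𝓝[≠] p.1)
          (𝓝 (fderiv ℝ φ p (1, 0))) := by
        have := (hd.continuousAt_fderiv (by simp)).clm_apply
          (continuousAt_const (y := ((1 : ℝ), (0 : E))))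
        exact this.tendsto.comp hc
      have h2 : Tendsto (fun t : ℝ => X (φ (t, p.2))) (𝓝[≠] p.1) (𝓝 (X (φ p))) :=
        (hX.continuous.continuousAt.comp hd.continuousAt).tendsto.comp hc
      refine tendsto_nhds_unique h1 (h2.congr' ?_)
      filter_upwards [hc.eventually hp, self_mem_nhdsWithin] with t ht ht'
      exact (ht (by simpa [hne] using ht')).symm
    · exact hp.self_of_nhds hne
  · have hc : ContinuousAt (fun x : E => ((0 : ℝ), x)) x₀ := by fun_prop
    filter_upwards [hc.eventually hsol] with x hx
    have h1 := congrArg (fun γ : C(unitInterval, E) => γ 1) hx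
    simpa [pathDefect, sub_eq_zero] using h1

end Flow

/-! ### Germs of diffeomorphisms and preserved bilinear forms -/

section GermDiffeo

variable {E : Type*} [NormedAddCommGroup E] [NormedSpace ℝ E]
  {B : Type*} [TopologicalSpace B] {I : ModelWithCorners ℝ E B}
  {M : Type*} [TopologicalSpace M] [ChartedSpace B M]
  {E' : Type*} [NormedAddCommGroup E'] [NormedSpace ℝ E']
  {B' : Type*} [TopologicalSpace B'] {I' : ModelWithCorners ℝ E' B'}
  {M' : Type*} [TopologicalSpace M'] [ChartedSpace B' M']
  {E'' : Type*} [NormedAddCommGroup E''] [NormedSpace ℝ E'']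
  {B'' : Type*} [TopologicalSpace B''] {I'' : ModelWithCorners ℝ E'' B''}
  {M'' : Type*} [TopologicalSpace M''] [ChartedSpace B'' M'']

/-- `f` maps a neighbourhood of `u` diffeomorphically onto a neighbourhood of `u'`, and `g` is
inverse to it near `u'`. -/
structure GermDiffeo (I : ModelWithCorners ℝ E B) (I' : ModelWithCorners ℝ E' B')
    (f : M → M') (g : M' → M) (u : M) (u' : M') : Prop where
  map : f u = u'
  map_inv : g u' = u
  smooth : ∀ᶠ x in 𝓝 u, ContMDiffAt I I' ∞ f x
  smooth_inv : ∀ᶠ x in 𝓝 u', ContMDiffAt I' I ∞ g x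
  left_inv : ∀ᶠ x in 𝓝 u, g (f x) = x
  right_inv : ∀ᶠ x in 𝓝 u', f (g x) = x

variable {f : M → M'} {g : M' → M} {f' : M' → M''} {g' : M'' → M'} {u : M} {u' : M'} {u'' : M''}

namespace GermDiffeo

theorem symm (h : GermDiffeo I I' f g u u') : GermDiffeo I' I g f u' u :=
  ⟨h.map_inv, h.map, h.smooth_inv, h.smooth, h.right_inv, h.left_inv⟩

theorem tendsto (h : GermDiffeo I I' f g u u') : Tendsto f (𝓝 u) (𝓝 u') := by
  have := h.smooth.self_of_nhds.continuousAt.tendsto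
  rwa [h.map] at this

theorem trans (h : GermDiffeo I I' f g u u') (h' : GermDiffeo I' I'' f' g' u' u'') :
    GermDiffeo I I'' (f' ∘ f) (g ∘ g') u u'' where
  map := by simp [h.map, h'.map]
  map_inv := by simp [h.map_inv, h'.map_inv]
  smooth := by
    filter_upwards [h.smooth, h.tendsto.eventually h'.smooth] with x h1 h2 using h2.comp x h1
  smooth_inv := by
    filter_upwards [h'.smooth_inv, h'.symm.tendsto.eventually h.smooth_inv] with x h1 h2
      using h2.comp x h1
  left_inv := by
    filter_upwards [h.left_inv, h.tendsto.eventually h'.left_inv] with x h1 h2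
    simp [h1, h2]
  right_inv := by
    filter_upwards [h'.right_inv, h'.symm.tendsto.eventually h.right_inv] with x h1 h2
    simp [h1, h2]

theorem mfderiv_left_inv (h : GermDiffeo I I' f g u u') :
    ∀ᶠ x in 𝓝 u, ∀ v : TangentSpace I x, mfderiv I' I g (f x) (mfderiv I I' f x v) = v := by
  filter_upwards [h.smooth, h.tendsto.eventually h.smooth_inv, h.left_inv.eventually_nhds]
    with x h1 h2 h3 v
  have hc := mfderiv_comp x (h2.mdifferentiableAt (by simp)) (h1.mdifferentiableAt (by simp))
  have he : (g ∘ f) =ᶠ[𝓝 x] id := h3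
  have hx : g (f x) = x := h3.self_of_nhds
  have hd := he.mfderiv_eq (I := I) (I' := I)
  rw [hc, mfderiv_id] at hd
  exact congrArg (fun A : E →L[ℝ] E => A v) hd

theorem mfderiv_right_inv (h : GermDiffeo I I' f g u u') :
    ∀ᶠ x in 𝓝 u, ∀ v : TangentSpace I' (f x),
      mfderiv I I' f x (mfderiv I' I g (f x) v) = v := by
  filter_upwards [h.left_inv, h.tendsto.eventually h.symm.mfderiv_left_inv] with x h1 h2 v
  have := h2 v
  rwa [h1] at this

theorem inverse_mfderiv (h : GermDiffeo I I' f g u u') :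
    ∀ᶠ x in 𝓝 u, (mfderiv I I' f x).inverse = mfderiv I' I g (f x) := by
  filter_upwards [h.mfderiv_left_inv, h.mfderiv_right_inv] with x h1 h2
  exact ContinuousLinearMap.inverse_eq (ContinuousLinearMap.ext h2) (ContinuousLinearMap.ext h1)

theorem isInvertible_mfderiv (h : GermDiffeo I I' f g u u') :
    ∀ᶠ x in 𝓝 u, (mfderiv I I' f x).IsInvertible := by
  filter_upwards [h.mfderiv_left_inv, h.mfderiv_right_inv] with x h1 h2
  exact ContinuousLinearMap.IsInvertible.of_inverse (ContinuousLinearMap.ext h2)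
    (ContinuousLinearMap.ext h1)

/-- Near `u'`, the pullback along `g` is the push-forward along `f`. -/
theorem mpullback_eq (h : GermDiffeo I I' f g u u') (Y : Π x : M, TangentSpace I x) :
    ∀ᶠ x in 𝓝 u', VectorField.mpullback I' I g Y x = mfderiv I I' f (g x) (Y (g x)) := by
  filter_upwards [h.symm.inverse_mfderiv] with x hx
  rw [VectorField.mpullback_apply, hx]
  rfl

end GermDiffeo

/-- `f` pulls the field `σ'` of bilinear forms back to `σ`, near `u`. -/
def PreservesForm (I : ModelWithCorners ℝ E B) (I' : ModelWithCorners ℝ E' B') (f : M → M') (u : M)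
    (σ : Π x : M, TangentSpace I x → TangentSpace I x → ℝ)
    (σ' : Π x : M', TangentSpace I' x → TangentSpace I' x → ℝ) : Prop :=
  ∀ᶠ x in 𝓝 u, ∀ v w, σ' (f x) (mfderiv I I' f x v) (mfderiv I I' f x w) = σ x v w

theorem PreservesForm.symm {σ : Π x : M, TangentSpace I x → TangentSpace I x → ℝ}
    {σ' : Π x : M', TangentSpace I' x → TangentSpace I' x → ℝ}
    (hσ : PreservesForm I I' f u σ σ') (h : GermDiffeo I I' f g u u') :
    PreservesForm I' I g u' σ' σ := by
  filter_upwards [h.symm.tendsto.eventually hσ, h.symm.mfderiv_left_inv, h.right_inv]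
    with x h1 h2 h3 v w
  -- `f (g x) = x` is not definitional, but all tangent spaces unfold to `E'`, so vectors may change
  -- base point unaltered.
  have key : ∀ y, y = x → ∀ a b : E', σ' y a b = σ' x a b := by
    rintro _ rfl _ _
    rfl
  exact (h1 _ _).symm.trans ((key _ h3 _ _).trans (congrArg₂ (σ' x) (h2 v) (h2 w)))

theorem PreservesForm.trans {σ : Π x : M, TangentSpace I x → TangentSpace I x → ℝ}
    {σ' : Π x : M', TangentSpace I' x → TangentSpace I' x → ℝ}
    {σ'' : Π x : M'', TangentSpace I'' x → TangentSpace I'' x → ℝ}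
    (hσ : PreservesForm I I' f u σ σ') (hσ' : PreservesForm I' I'' f' u' σ' σ'')
    (h : GermDiffeo I I' f g u u') (h' : GermDiffeo I' I'' f' g' u' u'') :
    PreservesForm I I'' (f' ∘ f) u σ σ'' := by
  filter_upwards [hσ, h.tendsto.eventually hσ', h.smooth, h.tendsto.eventually h'.smooth]
    with x h1 h2 h3 h4 v w
  rw [mfderiv_comp x (h4.mdifferentiableAt (by simp)) (h3.mdifferentiableAt (by simp)), ← h1, ← h2]
  rfl

end GermDiffeo

/-! ### Push-forward of germs of vector fields, as pullback along the inverse -/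

section Transfer

variable {E : Type*} [NormedAddCommGroup E] [NormedSpace ℝ E]
  {B : Type*} [TopologicalSpace B] {I : ModelWithCorners ℝ E B}
  {M : Type*} [TopologicalSpace M] [ChartedSpace B M] [IsManifold I ∞ M]
  {E' : Type*} [NormedAddCommGroup E'] [NormedSpace ℝ E'] [CompleteSpace E']
  {B' : Type*} [TopologicalSpace B'] {I' : ModelWithCorners ℝ E' B'}
  {M' : Type*} [TopologicalSpace M'] [ChartedSpace B' M'] [IsManifold I' ∞ M']
  {f : M → M'} {g : M' → M} {u : M} {u' : M'}

theorem IsSmoothNear.mpullback {Y : Π x : M, TangentSpace I x} (hY : IsSmoothNear I u Y)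
    (h : GermDiffeo I I' f g u u') : IsSmoothNear I' u' (VectorField.mpullback I' I g Y) := by
  have : IsManifold I 1 M := IsManifold.of_le (n := ∞) (by simp)
  have : IsManifold I' 1 M' := IsManifold.of_le (n := ∞) (by simp)
  filter_upwards [h.symm.tendsto.eventually hY, h.smooth_inv, h.symm.isInvertible_mfderiv]
    with x h1 h2 h3
  exact ContMDiffAt.mpullback_vectorField_preimage (n := ∞) h1 h2 h3 (by simp)

theorem mpullback_mlieBracket_eventually {Y Z : Π x : M, TangentSpace I x}
    (hY : IsSmoothNear I u Y) (hZ : IsSmoothNear I u Z) (h : GermDiffeo I I' f g u u') :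
    ∀ᶠ x in 𝓝 u', VectorField.mpullback I' I g (VectorField.mlieBracket I Y Z) x =
      VectorField.mlieBracket I' (VectorField.mpullback I' I g Y)
        (VectorField.mpullback I' I g Z) x := by
  have : IsManifold I (minSmoothness ℝ 2) M := by
    rw [minSmoothness_of_isRCLikeNormedField]; infer_instance
  have : IsManifold I' (minSmoothness ℝ 2) M' := by
    rw [minSmoothness_of_isRCLikeNormedField]; infer_instance
  filter_upwards [h.symm.tendsto.eventually hY.mdiff, h.symm.tendsto.eventually hZ.mdiff,
    h.smooth_inv] with x h1 h2 h3
  refine VectorField.mpullback_mlieBracket (n := ∞) h1 h2 h3 ?_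
  rw [minSmoothness_of_isRCLikeNormedField]; exact ENat.LEInfty.out

/-- Push-forward of germs of vector fields, as a linear map. -/
noncomputable def pushGerm (h : GermDiffeo I I' f g u u') : VFGerm I u →ₗ[ℝ] VFGerm I' u' :=
  Submodule.mapQ _ _
    { toFun := fun Y => (⟨VectorField.mpullback I' I g Y.1, IsSmoothNear.mpullback Y.2 h⟩ :
        smoothNear I' u')
      map_add' := fun Y Z => Subtype.ext VectorField.mpullback_add
      map_smul' := fun c Y => Subtype.ext VectorField.mpullback_const_smul }
    (by
      intro Y hY
      show ∀ᶠ x in 𝓝 u', VectorField.mpullback I' I g Y.1 x = 0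
      filter_upwards [h.symm.tendsto.eventually hY] with x hx
      rw [VectorField.mpullback_apply, hx, map_zero])

theorem pushGerm_mk (h : GermDiffeo I I' f g u u') {Y : Π x : M, TangentSpace I x}
    (hY : IsSmoothNear I u Y) :
    pushGerm h (VFGerm.mk Y hY) = VFGerm.mk (VectorField.mpullback I' I g Y) (hY.mpullback h) := rfl

theorem pushGerm_symm_pushGerm [CompleteSpace E] (h : GermDiffeo I I' f g u u') (y : VFGerm I u) :
    pushGerm h.symm (pushGerm h y) = y := by
  obtain ⟨Y, hY, rfl⟩ := y.exists_rep
  rw [pushGerm_mk, pushGerm_mk]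
  refine VFGerm.mk_eq_mk.2 ?_
  filter_upwards [h.symm.mpullback_eq (VectorField.mpullback I' I g Y),
    h.tendsto.eventually (h.mpullback_eq Y), h.left_inv, h.mfderiv_left_inv] with x h1 h2 h3 h4
  rw [h1, h2, h3]
  exact h4 _

theorem pushGerm_lie [CompleteSpace E] (h : GermDiffeo I I' f g u u') (y z : VFGerm I u) :
    pushGerm h ⁅y, z⁆ = ⁅pushGerm h y, pushGerm h z⁆ := by
  obtain ⟨Y, hY, rfl⟩ := y.exists_rep
  obtain ⟨Z, hZ, rfl⟩ := z.exists_rep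
  rw [VFGerm.lie_mk, pushGerm_mk, pushGerm_mk, pushGerm_mk, VFGerm.lie_mk]
  exact VFGerm.mk_eq_mk.2 (mpullback_mlieBracket_eventually hY hZ h)

/-- Push-forward of germs of vector fields along a germ of diffeomorphism. -/
noncomputable def pushGermEquiv [CompleteSpace E] (h : GermDiffeo I I' f g u u') :
    VFGerm I u ≃ₗ⁅ℝ⁆ VFGerm I' u' :=
  { pushGerm h with
    map_lie' := fun {y z} => pushGerm_lie h y z
    invFun := pushGerm h.symm
    left_inv := pushGerm_symm_pushGerm h
    right_inv := pushGerm_symm_pushGerm h.symm }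

end Transfer

/-! ### Straightening a Hamiltonian on a symplectic vector space -/

section SymplecticVectorSpace

variable {P : Type u} [NormedAddCommGroup P] [NormedSpace ℝ P]

/-- `Ω` is a symplectic form on the vector space `P`. -/
structure IsSymplectic (Ω : P →L[ℝ] P →L[ℝ] ℝ) : Prop where
  self_eq_zero : ∀ x, Ω x x = 0
  nondegenerate : ∀ x, (∀ y, Ω x y = 0) → x = 0

theorem IsSymplectic.swap {Ω : P →L[ℝ] P →L[ℝ] ℝ} (hΩ : IsSymplectic Ω) (x y : P) :
    Ω x y = -Ω y x := by
  have h := hΩ.self_eq_zero (x + y)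
  simp only [map_add, add_apply, hΩ.self_eq_zero] at h
  linarith

variable [FiniteDimensional ℝ P]

theorem IsSymplectic.exists_sharp {Ω : P →L[ℝ] P →L[ℝ] ℝ} (hΩ : IsSymplectic Ω) :
    ∃ S : (P →L[ℝ] ℝ) →L[ℝ] P, ∀ α, Ω (S α) = α := by
  have hinj : Function.Injective (Ω : P →ₗ[ℝ] P →L[ℝ] ℝ) := by
    rw [injective_iff_map_eq_zero]
    intro x hx
    exact hΩ.nondegenerate x fun y => congrArg (fun A : P →L[ℝ] ℝ => A y) hx
  have hrank : Module.finrank ℝ P = Module.finrank ℝ (P →L[ℝ] ℝ) := by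
    rw [← (LinearMap.toContinuousLinearMap : (P →ₗ[ℝ] ℝ) ≃ₗ[ℝ] P →L[ℝ] ℝ).finrank_eq]
    exact Subspace.dual_finrank_eq.symm
  let e := LinearEquiv.ofInjectiveOfFinrankEq _ hinj hrank
  exact ⟨LinearMap.toContinuousLinearMap e.symm.toLinearMap, fun α => e.apply_symm_apply α⟩

theorem exists_germDiffeo_of_injective_fderiv {f : P → P} {a : P}
    (hf : ∀ᶠ x in 𝓝 a, ContDiffAt ℝ ∞ f x) (hinj : ∀ ξ, fderiv ℝ f a ξ = 0 → ξ = 0) :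
    ∃ g : P → P, GermDiffeo 𝓘(ℝ, P) 𝓘(ℝ, P) f g a (f a) := by
  have hi : Function.Injective (fderiv ℝ f a : P →ₗ[ℝ] P) := (injective_iff_map_eq_zero _).2 hinj
  let A := (LinearEquiv.ofInjectiveEndo _ hi).toContinuousLinearEquiv
  have hA : (A : P →L[ℝ] P) = fderiv ℝ f a := by
    ext x
    rfl
  have hd := (hf.self_of_nhds.differentiableAt (by simp)).hasFDerivAt
  rw [← hA] at hd
  obtain ⟨e, ha, hcoe, h1, h2⟩ := exists_smooth_openPartialHomeomorph hf A hd
  have hfa : f a ∈ e.target := by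
    rw [← hcoe]
    exact e.map_source ha
  refine ⟨e.symm, rfl, ?_, ?_, ?_, ?_, ?_⟩
  · rw [← hcoe]
    exact e.left_inv ha
  · filter_upwards [hf] with x hx using hx.contMDiffAt
  · filter_upwards [e.open_target.mem_nhds hfa] with y hy using (h2 y hy).contMDiffAt
  · filter_upwards [e.open_source.mem_nhds ha] with x hx
    rw [← hcoe]
    exact e.left_inv hx
  · filter_upwards [e.open_target.mem_nhds hfa] with y hy
    rw [← hcoe]
    exact e.right_inv hy

/-- A local Hamiltonian flow preserves the symplectic form and the Hamiltonian. -/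
theorem exists_hamiltonian_flow {Ω : P →L[ℝ] P →L[ℝ] ℝ} (hΩ : IsSymplectic Ω) {H : P → ℝ}
    (hH : ContDiff ℝ ∞ H) (z₀ : P) :
    ∃ φ : ℝ × P → P, φ (0, z₀) = z₀ ∧ ∀ᶠ p in 𝓝 ((0 : ℝ), z₀), ContDiffAt ℝ ∞ φ p ∧
      (∀ a, Ω (fderiv ℝ φ p (1, 0)) a = fderiv ℝ H (φ p) a) ∧
      (∀ a b, Ω (fderiv ℝ φ p (0, a)) (fderiv ℝ φ p (0, b)) = Ω a b) ∧ H (φ p) = H p.2 := by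
  obtain ⟨S, hS⟩ := hΩ.exists_sharp
  have hH' : ContDiff ℝ ∞ (fderiv ℝ H) := hH.fderiv_right (by simp)
  have hX : ContDiff ℝ ∞ fun z => S (fderiv ℝ H z) := S.contDiff.comp hH'
  obtain ⟨φ, hφ, hode, hinit⟩ := exists_smooth_flow _ hX z₀
  have hpartial : ∀ p : ℝ × P, ∀ k : ℝ × P → P, DifferentiableAt ℝ k p →
      HasDerivAt (fun t => k (t, p.2)) (fderiv ℝ k p (1, 0)) p.1 := by
    intro p k hp
    exact hp.hasFDerivAt.comp_hasDerivAt (f := fun t => (t, p.2)) p.1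
      ((hasDerivAt_id p.1).prodMk (hasDerivAt_const p.1 p.2))
  have hode' : ∀ᶠ p in 𝓝 ((0 : ℝ), z₀), fderiv ℝ φ p (1, 0) = S (fderiv ℝ H (φ p)) := by
    filter_upwards [hφ, hode] with p h1 h2
    exact (hpartial p φ (h1.differentiableAt (by simp))).unique h2
  -- The variational equation along the flow: the spatial derivative `Dφ` satisfies the linearised
  -- equation, by symmetry of the second derivative of `φ`.
  have hvar : ∀ᶠ p in 𝓝 ((0 : ℝ), z₀), ∀ a, HasDerivAt (fun t => fderiv ℝ φ (t, p.2) (0, a))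
      (S (fderiv ℝ (fderiv ℝ H) (φ p) (fderiv ℝ φ p (0, a)))) p.1 := by
    filter_upwards [hφ, hode'.eventually_nhds] with p h1 h2 a
    have hd : DifferentiableAt ℝ (fderiv ℝ φ) p :=
      (h1.fderiv_right (m := ∞) (by simp)).differentiableAt (by simp)
    have hsymm : IsSymmSndFDerivAt ℝ φ p := h1.isSymmSndFDerivAt (by
      rw [minSmoothness_of_isRCLikeNormedField]; exact ENat.LEInfty.out)
    have h3 := hpartial p (fun q => fderiv ℝ φ q (0, a)) (by fun_prop)
    have h4 : fderiv ℝ (fun q => fderiv ℝ φ q (0, a)) p (1, 0) =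
        S (fderiv ℝ (fderiv ℝ H) (φ p) (fderiv ℝ φ p (0, a))) := by
      have e1 : fderiv ℝ (fun q => fderiv ℝ φ q (0, a)) p (1, 0) =
          fderiv ℝ (fderiv ℝ φ) p (1, 0) (0, a) := by
        rw [fderiv_clm_apply hd (by fun_prop)]
        simp
      have e2 : fderiv ℝ (fun q => fderiv ℝ φ q (1, 0)) p (0, a) =
          fderiv ℝ (fderiv ℝ φ) p (0, a) (1, 0) := by
        rw [fderiv_clm_apply hd (by fun_prop)]
        simp
      have e3 : fderiv ℝ (fun q => fderiv ℝ φ q (1, 0)) p =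
          fderiv ℝ (fun q => S (fderiv ℝ H (φ q))) p := Filter.EventuallyEq.fderiv_eq h2
      have e4 : HasFDerivAt (fun q => S (fderiv ℝ H (φ q)))
          (S.comp ((fderiv ℝ (fderiv ℝ H) (φ p)).comp (fderiv ℝ φ p))) p :=
        S.hasFDerivAt.comp p (((hH'.differentiable (by simp) (φ p)).hasFDerivAt).comp p
          (h1.differentiableAt (by simp)).hasFDerivAt)
      rw [e1, hsymm, ← e2, e3, e4.fderiv]
      rfl
    rw [← h4]
    exact h3
  -- Symmetry of the Hessian of `H` makes `S ∘ D²H` infinitesimally symplectic, so `Ω (Dφ a) (Dφ b)`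
  -- is constant in time.
  have hΩ' : ∀ z a b, Ω (S (fderiv ℝ (fderiv ℝ H) z a)) b + Ω a (S (fderiv ℝ (fderiv ℝ H) z b)) = 0
      := by
    intro z a b
    have hsymm : IsSymmSndFDerivAt ℝ H z := hH.contDiffAt.isSymmSndFDerivAt (by
      rw [minSmoothness_of_isRCLikeNormedField]; exact ENat.LEInfty.out)
    rw [hΩ.swap a, hS, hS, hsymm, add_neg_cancel]
  have hinit' : ∀ᶠ x in 𝓝 z₀, ∀ a, fderiv ℝ φ (0, x) (0, a) = a := by
    have hc : ContinuousAt (fun x : P => ((0 : ℝ), x)) z₀ := by fun_prop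
    filter_upwards [hc.eventually hφ, hinit.eventually_nhds] with x h1 h2 a
    have h3 : HasFDerivAt (fun x : P => ((0 : ℝ), x)) (ContinuousLinearMap.inr ℝ ℝ P) x :=
      hasFDerivAt_prodMk_right 0 x
    have h4 := (h1.differentiableAt (by simp)).hasFDerivAt.comp x h3
    have h5 : HasFDerivAt (φ ∘ fun x : P => ((0 : ℝ), x)) (ContinuousLinearMap.id ℝ P) x :=
      (hasFDerivAt_id x).congr_of_eventuallyEq h2
    exact congrArg (fun A : P →L[ℝ] P => A a) (h4.unique h5)
  refine ⟨φ, hinit.self_of_nhds, ?_⟩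
  -- The product metric is a maximum, so for `p` close to `(0, z₀)` all times from `0` to `p.1` stay
  -- where the equations hold, and conserved quantities can be compared with time `0`.
  obtain ⟨r, hr, hball⟩ := Metric.eventually_nhds_iff_ball.1
    (hφ.and (hode'.and hvar))
  obtain ⟨r', hr', hball'⟩ := Metric.eventually_nhds_iff_ball.1 (hinit.and hinit')
  filter_upwards [hφ, hode', Metric.ball_mem_nhds ((0 : ℝ), z₀) (lt_min hr hr')] with p h1 h2 hp
  refine ⟨h1, fun a => by rw [h2, hS], ?_⟩
  rw [Metric.mem_ball, Prod.dist_eq, max_lt_iff] at hp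
  have hp2 : p.2 ∈ Metric.ball z₀ r' := hp.2.trans_le (min_le_right _ _)
  have hgood : ∀ t ∈ Metric.ball (0 : ℝ) r, (t, p.2) ∈ Metric.ball ((0 : ℝ), z₀) r := by
    intro t ht
    rw [Metric.mem_ball, Prod.dist_eq, max_lt_iff]
    exact ⟨ht, hp.2.trans_le (min_le_left _ _)⟩
  have hp1 : p.1 ∈ Metric.ball (0 : ℝ) r := hp.1.trans_le (min_le_left _ _)
  have hconst : ∀ k : ℝ → ℝ, (∀ t ∈ Metric.ball (0 : ℝ) r, HasDerivAt k 0 t) → k p.1 = k 0 := by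
    intro k hk
    exact Metric.isOpen_ball.is_const_of_deriv_eq_zero (convex_ball (0 : ℝ) r).isPreconnected
      (fun t ht => (hk t ht).differentiableAt.differentiableWithinAt)
      (fun t ht => (hk t ht).deriv) hp1 (Metric.mem_ball_self hr)
  refine ⟨fun a b => ?_, ?_⟩
  · have := hconst (fun t => Ω (fderiv ℝ φ (t, p.2) (0, a)) (fderiv ℝ φ (t, p.2) (0, b))) (by
      intro t ht
      obtain ⟨-, -, h3⟩ := hball _ (hgood t ht)
      have h4 := (Ω.hasFDerivAt.comp_hasDerivAt t (h3 a)).clm_apply (h3 b)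
      refine h4.congr_deriv ?_
      exact hΩ' _ _ _)
    simp only [(hball' _ hp2).2] at this
    exact this
  · have := hconst (fun t => H (φ (t, p.2))) (by
      intro t ht
      obtain ⟨h3, h4, -⟩ := hball _ (hgood t ht)
      have h5 := (hH.differentiable (by simp) (φ (t, p.2))).hasFDerivAt.comp_hasDerivAt t
        (hpartial (t, p.2) φ (h3.differentiableAt (by simp)))
      refine h5.congr_deriv ?_
      have h6 := hΩ.self_eq_zero (S (fderiv ℝ H (φ (t, p.2))))
      rw [hS] at h6
      rw [h4, h6])
    simp only [(hball' _ hp2).1] at this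
    exact this

/-- Symplectic straightening of a Hamiltonian near a regular point. -/
theorem exists_symplectic_straightening {Ω : P →L[ℝ] P →L[ℝ] ℝ} (hΩ : IsSymplectic Ω) {H : P → ℝ}
    (hH : ContDiff ℝ ∞ H) (z₀ v w : P) (hv : fderiv ℝ H z₀ v ≠ 0) (hwv : Ω w v = 1) :
    ∃ f g : P → P, GermDiffeo 𝓘(ℝ, P) 𝓘(ℝ, P) f g 0 z₀ ∧
      PreservesForm 𝓘(ℝ, P) 𝓘(ℝ, P) f 0 (fun _ a b => Ω a b) (fun _ a b => Ω a b) ∧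
      ∀ᶠ x in 𝓝 0, H (f x) = H z₀ + Ω w x := by
  obtain ⟨φ, hφ0, hφ⟩ := exists_hamiltonian_flow hΩ hH z₀
  let τ : P →L[ℝ] ℝ := Ω.flip v
  -- Since `Ω w v = 1`, `m` is the projection along `w` onto the hyperplane `ker τ`. `K` flows the
  -- point `z₀ + m x` of the affine hyperplane for the time `τ x`.
  let m : P →L[ℝ] P := ContinuousLinearMap.id ℝ P - τ.smulRight w
  have hm : ∀ x, m x = x - Ω x v • w := fun x => rfl
  let K : P → P := fun x => φ (τ x, z₀ + m x)
  -- The shear along `v` chosen so that `Ω w (G x) = H (z₀ + m x) - H z₀`, which is also `H (K x) -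
  -- H z₀` near `0` because the flow conserves `H`.
  let G : P → P := fun x => x + (H (z₀ + m x) - H z₀ - Ω w x) • v
  have hq : Continuous fun x : P => (τ x, z₀ + m x) := by fun_prop
  have hφ' : ∀ᶠ x in 𝓝 (0 : P), _ := (hq.tendsto' 0 (0, z₀) (by simp)).eventually hφ
  have hG : ContDiff ℝ ∞ G := by
    unfold G
    fun_prop
  have hKs : ∀ᶠ x in 𝓝 (0 : P), ContDiffAt ℝ ∞ K x := by
    filter_upwards [hφ'] with x hx
    exact hx.1.comp x (by fun_prop)
  have hDG : ∀ x ξ, fderiv ℝ G x ξ = ξ + (fderiv ℝ H (z₀ + m x) (m ξ) - Ω w ξ) • v := by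
    intro x ξ
    have h1 : HasFDerivAt (fun x => z₀ + m x) m x := m.hasFDerivAt.const_add z₀
    have h2 := (hH.differentiable (by simp) (z₀ + m x)).hasFDerivAt.comp x h1
    have h3 : HasFDerivAt G _ x :=
      (hasFDerivAt_id x).add (((h2.sub_const (H z₀)).sub (Ω w).hasFDerivAt).smul_const v)
    rw [h3.fderiv]
    rfl
  have hDK : ∀ᶠ x in 𝓝 (0 : P), ∀ ξ, fderiv ℝ K x ξ =
      Ω ξ v • fderiv ℝ φ (τ x, z₀ + m x) (1, 0) + fderiv ℝ φ (τ x, z₀ + m x) (0, m ξ) := by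
    filter_upwards [hφ'] with x hx ξ
    have h1 : HasFDerivAt (fun x => (τ x, z₀ + m x)) (τ.prod m) x :=
      τ.hasFDerivAt.prodMk (m.hasFDerivAt.const_add z₀)
    have h2 : HasFDerivAt K _ x := (hx.1.differentiableAt (by simp)).hasFDerivAt.comp x h1
    rw [h2.fderiv, ContinuousLinearMap.comp_apply, ← map_smul, ← map_add]
    simp [τ]
  -- Both sides reduce to the same expression in `Ω`, `dH` at `z₀ + m x`, `v` and `w`: for `K`, the
  -- flow is symplectic, and pairing its time derivative with the spatial derivative along `a` gives
  -- `dH a` at the starting point.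
  have hform : ∀ᶠ x in 𝓝 (0 : P), ∀ ξ η, Ω (fderiv ℝ K x ξ) (fderiv ℝ K x η) =
      Ω (fderiv ℝ G x ξ) (fderiv ℝ G x η) := by
    filter_upwards [hφ', (hq.tendsto' 0 (0, z₀) (by simp)).eventually hφ.eventually_nhds, hDK]
      with x hx hx' hDKx ξ η
    obtain ⟨h2, h3, h4, h5⟩ := hx
    have h1 : ∀ a, fderiv ℝ H (φ (τ x, z₀ + m x)) (fderiv ℝ φ (τ x, z₀ + m x) (0, a)) =
        fderiv ℝ H (z₀ + m x) a := by
      intro a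
      have e1 := (hH.differentiable (by simp) (φ (τ x, z₀ + m x))).hasFDerivAt.comp
        (τ x, z₀ + m x) (h2.differentiableAt (by simp)).hasFDerivAt
      have e2 := (hH.differentiable (by simp) (z₀ + m x)).hasFDerivAt.comp
        (f := Prod.snd) (τ x, z₀ + m x) hasFDerivAt_snd
      have e3 : H ∘ φ =ᶠ[𝓝 (τ x, z₀ + m x)] H ∘ Prod.snd := by
        filter_upwards [hx'] with p hp using hp.2.2.2
      exact congrArg (fun A : ℝ × P →L[ℝ] ℝ => A (0, a))
        (e1.unique (e2.congr_of_eventuallyEq e3))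
    have h6 : ∀ a, Ω (fderiv ℝ φ (τ x, z₀ + m x) (1, 0)) (fderiv ℝ φ (τ x, z₀ + m x) (0, a)) =
        fderiv ℝ H (z₀ + m x) a := fun a => by rw [h3, h1]
    have h7 : ∀ a, Ω (fderiv ℝ φ (τ x, z₀ + m x) (0, a)) (fderiv ℝ φ (τ x, z₀ + m x) (1, 0)) =
        -fderiv ℝ H (z₀ + m x) a := fun a => by rw [hΩ.swap, h6]
    have h8 : Ω (m ξ) (m η) = Ω ξ η - Ω η v * Ω ξ w - Ω ξ v * Ω w η := by
      simp only [hm, map_sub, map_smul, sub_apply, smul_apply, smul_eq_mul, hΩ.self_eq_zero]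
      ring
    rw [hDKx, hDKx, hDG, hDG]
    simp only [map_add, map_smul, add_apply, smul_apply, smul_eq_mul, h4, h6, h7, h8,
      hΩ.self_eq_zero]
    rw [hΩ.swap v η, hΩ.swap ξ w]
    ring
  have hv0 : v ≠ 0 := by
    rintro rfl
    simp at hv
  have hG0 : G 0 = 0 := by simp [G]
  have hK0 : K 0 = z₀ := by simp [K, hφ0]
  -- A kernel vector must be `c • v`, and the derivative sends `c • v` to `(c * dH v) • v`;
  -- regularity along `v` forces `c = 0`.
  have hGinj : ∀ ξ, fderiv ℝ G 0 ξ = 0 → ξ = 0 := by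
    intro ξ hξ
    rw [hDG, map_zero, add_zero] at hξ
    obtain ⟨c, rfl⟩ : ∃ c : ℝ, ξ = c • v :=
      ⟨-(fderiv ℝ H z₀ (m ξ) - Ω w ξ), by rw [neg_smul]; exact eq_neg_of_add_eq_zero_left hξ⟩
    have hmv : m v = v := by simp [hm, hΩ.self_eq_zero]
    rw [map_smul, hmv, map_smul, map_smul, hwv, ← add_smul, smul_eq_zero] at hξ
    have hc : c * fderiv ℝ H z₀ v = 0 := by
      have := hξ.resolve_right hv0
      simpa using this
    rw [(mul_eq_zero.1 hc).resolve_right hv, zero_smul]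
  -- The pullbacks of `Ω` by `K` and `G` agree, and the latter is nondegenerate at `0`.
  have hKinj : ∀ ξ, fderiv ℝ K 0 ξ = 0 → ξ = 0 := by
    intro ξ hξ
    have hi : Function.Injective (fderiv ℝ G 0 : P →ₗ[ℝ] P) :=
      (injective_iff_map_eq_zero _).2 hGinj
    refine hGinj ξ (hΩ.nondegenerate _ fun y => ?_)
    obtain ⟨η, rfl⟩ := LinearMap.injective_iff_surjective.1 hi y
    have := hform.self_of_nhds ξ η
    rw [hξ, map_zero] at this
    exact this.symm
  obtain ⟨gG, hgG⟩ := exists_germDiffeo_of_injective_fderiv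
    (Eventually.of_forall fun x => hG.contDiffAt) hGinj
  obtain ⟨gK, hgK⟩ := exists_germDiffeo_of_injective_fderiv hKs hKinj
  rw [hG0] at hgG
  rw [hK0] at hgK
  -- `G` and `K` pull `Ω` back to one common form, so it cancels in `K ∘ gG`.
  have hpG : PreservesForm 𝓘(ℝ, P) 𝓘(ℝ, P) G 0
      (fun x a b => Ω (fderiv ℝ G x a) (fderiv ℝ G x b)) (fun _ a b => Ω a b) := by
    refine Eventually.of_forall fun x a b => ?_
    rw [mfderiv_eq_fderiv]
    rfl
  have hpK : PreservesForm 𝓘(ℝ, P) 𝓘(ℝ, P) K 0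
      (fun x a b => Ω (fderiv ℝ G x a) (fderiv ℝ G x b)) (fun _ a b => Ω a b) := by
    filter_upwards [hform] with x hx a b
    rw [mfderiv_eq_fderiv]
    exact hx a b
  refine ⟨K ∘ gG, G ∘ gK, hgG.symm.trans hgK, (hpG.symm hgG).trans hpK hgG.symm hgK, ?_⟩
  filter_upwards [hgG.right_inv, hgG.symm.tendsto.eventually hφ'] with x h1 h2
  have h3 : H (K (gG x)) = H (z₀ + m (gG x)) := h2.2.2.2
  rw [Function.comp_apply, h3]
  nth_rewrite 2 [← h1]
  simp only [G, map_add, map_smul, hwv, smul_eq_mul]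
  ring

/-- Any two regular points of Hamiltonians have neighbourhoods which are related by a
symplectomorphism that matches the Hamiltonians up to a constant. -/
theorem exists_symplectic_conjugation {Ω : P →L[ℝ] P →L[ℝ] ℝ} (hΩ : IsSymplectic Ω) {H H' : P → ℝ}
    {z z' : P} (hH : ContDiff ℝ ∞ H) (hH' : ContDiff ℝ ∞ H')
    (hz : fderiv ℝ H z ≠ 0) (hz' : fderiv ℝ H' z' ≠ 0) :
    ∃ f g : P → P, GermDiffeo 𝓘(ℝ, P) 𝓘(ℝ, P) f g z z' ∧
      PreservesForm 𝓘(ℝ, P) 𝓘(ℝ, P) f z (fun _ a b => Ω a b) (fun _ a b => Ω a b) ∧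
      ∀ᶠ x in 𝓝 z, H' (f x) = H x + (H' z' - H z) := by
  -- Two proper subspaces, the kernels of `dH` and `dH'`, do not cover `P`. A common `v`, hence a
  -- common `w`, gives both Hamiltonians the same linear normal form.
  obtain ⟨v, hv, hv'⟩ : ∃ v, fderiv ℝ H z v ≠ 0 ∧ fderiv ℝ H' z' v ≠ 0 := by
    obtain ⟨a, ha⟩ : ∃ a, fderiv ℝ H z a ≠ 0 := by
      by_contra! h
      exact hz (ContinuousLinearMap.ext h)
    obtain ⟨b, hb⟩ : ∃ b, fderiv ℝ H' z' b ≠ 0 := by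
      by_contra! h
      exact hz' (ContinuousLinearMap.ext h)
    by_cases ha' : fderiv ℝ H' z' a = 0
    · by_cases hb' : fderiv ℝ H z b = 0
      · exact ⟨a + b, by simpa [hb'] using ha, by simpa [ha'] using hb⟩
      · exact ⟨b, hb', hb⟩
    · exact ⟨a, ha, ha'⟩
  obtain ⟨w, hw⟩ : ∃ w, Ω w v = 1 := by
    obtain ⟨y, hy⟩ : ∃ y, Ω v y ≠ 0 := by
      by_contra! h
      refine hv ?_
      rw [hΩ.nondegenerate v h, map_zero]
    refine ⟨(Ω y v)⁻¹ • y, ?_⟩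
    have : Ω y v ≠ 0 := by rwa [hΩ.swap, neg_ne_zero]
    simp [this]
  obtain ⟨f, g, h1, h2, h3⟩ := exists_symplectic_straightening hΩ hH z v w hv hw
  obtain ⟨f', g', h1', h2', h3'⟩ := exists_symplectic_straightening hΩ hH' z' v w hv' hw
  refine ⟨f' ∘ g, f ∘ g', h1.symm.trans h1', (h2.symm h1).trans h2' h1.symm h1', ?_⟩
  filter_upwards [h1.right_inv, h1.symm.tendsto.eventually h3, h1.symm.tendsto.eventually h3']
    with x e1 e2 e3
  rw [e1] at e2
  rw [Function.comp_apply, e3, e2]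
  ring

/-- A cut-off by a bump function; the flow construction takes functions smooth on the whole space.
-/
theorem exists_contDiff_eventuallyEq {H : P → ℝ} {z : P} (hH : ∀ᶠ x in 𝓝 z, ContDiffAt ℝ ∞ H x) :
    ∃ H₀ : P → ℝ, ContDiff ℝ ∞ H₀ ∧ H₀ =ᶠ[𝓝 z] H := by
  obtain ⟨r, hr, hball⟩ := Metric.eventually_nhds_iff_ball.1 hH
  let b : ContDiffBump z := ⟨r / 4, r / 2, by positivity, by linarith⟩
  refine ⟨fun x => b x * H x, contMDiff_iff_contDiff.1 (contMDiff_of_tsupport fun x hx => ?_), ?_⟩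
  · have hx' : x ∈ tsupport b := closure_mono (Function.support_mul_subset_left _ _) hx
    rw [b.tsupport_eq] at hx'
    exact (b.contDiff.contDiffAt.mul (hball x (Metric.closedBall_subset_ball (by
      show r / 2 < r
      linarith) hx'))).contMDiffAt
  · filter_upwards [b.eventuallyEq_one] with x hx
    simp [hx]

end SymplecticVectorSpace

/-! ### Charts as germs of diffeomorphisms at every point of their source -/

section ChartGerm

variable {E : Type*} [NormedAddCommGroup E] [NormedSpace ℝ E]
  {B : Type*} [TopologicalSpace B] {I : ModelWithCorners ℝ E B} [I.Boundaryless]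
  {M : Type*} [TopologicalSpace M] [ChartedSpace B M] [IsManifold I ∞ M]

theorem germDiffeo_extChartAt {x₀ x : M} (hx : x ∈ (extChartAt I x₀).source) :
    GermDiffeo I 𝓘(ℝ, E) (extChartAt I x₀) (extChartAt I x₀).symm x (extChartAt I x₀ x) where
  map := rfl
  map_inv := (extChartAt I x₀).left_inv hx
  smooth := by
    filter_upwards [(isOpen_extChartAt_source x₀).mem_nhds hx] with y hy
    exact contMDiffAt_extChartAt' (by rwa [extChartAt_source] at hy)
  smooth_inv := by
    have ho : IsOpen (extChartAt I x₀).target := isOpen_extChartAt_target x₀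
    filter_upwards [ho.mem_nhds ((extChartAt I x₀).map_source hx)] with y hy
    exact (contMDiffOn_extChartAt_symm x₀).contMDiffAt (ho.mem_nhds hy)
  left_inv := by
    filter_upwards [(isOpen_extChartAt_source x₀).mem_nhds hx] with y hy
    exact (extChartAt I x₀).left_inv hy
  right_inv := by
    have ho : IsOpen (extChartAt I x₀).target := isOpen_extChartAt_target x₀
    filter_upwards [ho.mem_nhds ((extChartAt I x₀).map_source hx)] with y hy
    exact (extChartAt I x₀).right_inv hy

end ChartGerm

/-! ### The canonical forms of the model phase space -/

section Model

section Bilinear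

variable {P : Type*} [NormedAddCommGroup P] [NormedSpace ℝ P]

/-- The exterior derivative of the 1-form `z ↦ L z`. -/
noncomputable def extDerivBilin (L : P →L[ℝ] P →L[ℝ] ℝ) : P →L[ℝ] P →L[ℝ] ℝ := L - L.flip

theorem extDerivBilin_apply (L : P →L[ℝ] P →L[ℝ] ℝ) (v w : P) :
    extDerivBilin L v w = L v w - L w v := rfl

theorem fderiv_bilin (L : P →L[ℝ] P →L[ℝ] ℝ) (z : P) : fderiv ℝ (fun y => L y) z = L :=
  L.hasFDerivAt.fderiv

/-- A map preserving a 1-form preserves its exterior derivative: differentiate the identity `h` and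
antisymmetrise; the term with the second derivative of `ψ` is symmetric and drops out. -/
theorem extDerivBilin_fderiv {L : P →L[ℝ] P →L[ℝ] ℝ} {ψ : P → P} {z : P}
    (hψ : ContDiffAt ℝ ∞ ψ z) (h : ∀ᶠ y in 𝓝 z, L y = (L (ψ y)).comp (fderiv ℝ ψ y)) (v w : P) :
    extDerivBilin L (fderiv ℝ ψ z v) (fderiv ℝ ψ z w) = extDerivBilin L v w := by
  have hd : DifferentiableAt ℝ (fderiv ℝ ψ) z :=
    (hψ.fderiv_right (m := ∞) (by simp)).differentiableAt (by simp)
  have hsymm : IsSymmSndFDerivAt ℝ ψ z := hψ.isSymmSndFDerivAt (by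
    rw [minSmoothness_of_isRCLikeNormedField]; exact ENat.LEInfty.out)
  have h1 := (L.hasFDerivAt.comp z
    (hψ.differentiableAt (by simp)).hasFDerivAt).clm_comp hd.hasFDerivAt
  have h2 := L.hasFDerivAt.unique (h1.congr_of_eventuallyEq h)
  have h3 : ∀ a b, L a b = L (ψ z) (fderiv ℝ (fderiv ℝ ψ) z a b) +
      L (fderiv ℝ ψ z a) (fderiv ℝ ψ z b) := by
    intro a b
    exact congrArg (fun A : P →L[ℝ] P →L[ℝ] ℝ => A a b) h2
  rw [extDerivBilin_apply, extDerivBilin_apply, h3 v w, h3 w v, hsymm v w]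
  ring

end Bilinear

/-- The vector space `ℝⁿ × (ℝⁿ)*` on which `T*N` is modelled. -/
abbrev PhaseSpace (n : ℕ) : Type :=
  EuclideanSpace ℝ (Fin n) × (EuclideanSpace ℝ (Fin n) →L[ℝ] ℝ)

/-- The tautological form `p_i dq^i` of the model space. -/
noncomputable def modelTaut (n : ℕ) : PhaseSpace n →L[ℝ] PhaseSpace n →L[ℝ] ℝ :=
  ((ContinuousLinearMap.compL ℝ (PhaseSpace n) (EuclideanSpace ℝ (Fin n)) ℝ).flip
    (ContinuousLinearMap.fst ℝ _ _)).comp (ContinuousLinearMap.snd ℝ _ _)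

/-- The symplectic form `dp_i ∧ dq^i` of the model space. -/
noncomputable def modelSymp (n : ℕ) : PhaseSpace n →L[ℝ] PhaseSpace n →L[ℝ] ℝ :=
  extDerivBilin (P := PhaseSpace n) (modelTaut n)

theorem modelSymp_apply {n : ℕ} (v w : PhaseSpace n) :
    modelSymp n v w = v.2 w.1 - w.2 v.1 := rfl

theorem isSymplectic_modelSymp (n : ℕ) : IsSymplectic (P := PhaseSpace n) (modelSymp n) where
  self_eq_zero x := sub_self _
  nondegenerate := by
    rintro ⟨a, α⟩ h
    have h1 : α = 0 := by
      ext b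
      simpa [modelSymp_apply] using h (b, 0)
    -- Testing against the covector dual to `a` yields `‖a‖² = 0`.
    have h2 : a = 0 := by
      have := h (0, innerSL ℝ a)
      simpa [modelSymp_apply] using this
    rw [h1, h2]
    rfl

end Model

/-! ### Canonical forms of `T*N` in bundle charts -/

section Chart

variable {n : ℕ} {N : Type*} [TopologicalSpace N]
  [ChartedSpace (EuclideanSpace ℝ (Fin n)) N] [IsManifold (𝓡 n) ∞ N]

theorem extChartAt_cot_apply (x β : CotBundle n N) :
    extChartAt (cotModel n) x β = (extChartAt (𝓡 n) x.proj β.proj,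
      ContinuousLinearMap.inCoordinates (EuclideanSpace ℝ (Fin n)) (TangentSpace (𝓡 n) : N → Type _)
        ℝ (Bundle.Trivial N ℝ) x.proj β.proj x.proj β.proj β.snd) := by
  rw [FiberBundle.extChartAt]
  rfl

theorem proj_mem_of_mem_extChartAt_source {x β : CotBundle n N}
    (hβ : β ∈ (extChartAt (cotModel n) x).source) :
    β.proj ∈ (chartAt (EuclideanSpace ℝ (Fin n)) x.proj).source := by
  rw [FiberBundle.extChartAt] at hβ
  have h : β.proj ∈ (extChartAt (𝓡 n) x.proj).source := hβ.2.1
  rwa [extChartAt_source] at h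

theorem extChartAt_cot_snd {x β : CotBundle n N} (w : EuclideanSpace ℝ (Fin n)) :
    (extChartAt (cotModel n) x β).2 w =
      (β.snd : TangentSpace (𝓡 n) β.proj →L[ℝ] ℝ) ((trivializationAt (EuclideanSpace ℝ (Fin n))
        (TangentSpace (𝓡 n) : N → Type _) x.proj).symmL ℝ β.proj w) := by
  rw [extChartAt_cot_apply]
  simp [ContinuousLinearMap.inCoordinates]

/-- The chart's base component is the base chart after the projection, and its fibre component is
the covector precomposed with the inverse tangent trivialization; the trivialization and its inverse
cancel in the pairing. -/
theorem tautForm_eq {x β : CotBundle n N} (hβ : β ∈ (extChartAt (cotModel n) x).source)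
    (v : TangentSpace (cotModel n) β) :
    tautForm β v = modelTaut n (extChartAt (cotModel n) x β)
      (mfderiv (cotModel n) 𝓘(ℝ, PhaseSpace n) (extChartAt (cotModel n) x) β v) := by
  have : IsManifold (𝓡 n) 1 N := IsManifold.of_le (n := ∞) (by simp)
  have hb := proj_mem_of_mem_extChartAt_source hβ
  have hφ := (germDiffeo_extChartAt hβ).smooth.self_of_nhds.mdifferentiableAt (by simp)
  have h1 : (mfderiv (cotModel n) 𝓘(ℝ, PhaseSpace n) (extChartAt (cotModel n) x) β v).1 =
      mfderiv (𝓡 n) 𝓘(ℝ, EuclideanSpace ℝ (Fin n)) (extChartAt (𝓡 n) x.proj) β.proj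
        (mfderiv (cotModel n) (𝓡 n) (Bundle.TotalSpace.proj : CotBundle n N → N) β v) := by
    have e1 : (Prod.fst ∘ extChartAt (cotModel n) x : CotBundle n N → _) =
        extChartAt (𝓡 n) x.proj ∘ Bundle.TotalSpace.proj := by
      ext1 β'
      simp only [Function.comp_apply, extChartAt_cot_apply]
    have hp : MDifferentiableAt (cotModel n) (𝓡 n)
        (Bundle.TotalSpace.proj : CotBundle n N → N) β :=
      (Bundle.contMDiffAt_proj (n := ∞) _).mdifferentiableAt (by simp)
    have e2 := mfderiv_comp β (mdifferentiableAt_extChartAt (I := 𝓡 n) hb) hp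
    have hfst : MDifferentiableAt 𝓘(ℝ, PhaseSpace n) 𝓘(ℝ, EuclideanSpace ℝ (Fin n))
        (Prod.fst : PhaseSpace n → _) (extChartAt (cotModel n) x β) :=
      differentiableAt_fst.mdifferentiableAt
    have e3 := mfderiv_comp β hfst hφ
    rw [e1, e2, mfderiv_eq_fderiv, fderiv_fst] at e3
    exact (congrArg (fun A : PhaseSpace n →L[ℝ] EuclideanSpace ℝ (Fin n) => A v) e3).symm
  have h2 := (trivializationAt (EuclideanSpace ℝ (Fin n))
    (TangentSpace (𝓡 n) : N → Type _) x.proj).symmL_continuousLinearMapAt (R := ℝ)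
    (b := β.proj) (by simpa using hb)
      (mfderiv (cotModel n) (𝓡 n) (Bundle.TotalSpace.proj : CotBundle n N → N) β v)
  rw [TangentBundle.continuousLinearMapAt_trivializationAt hb] at h2
  refine Eq.trans ?_ ((extChartAt_cot_snd _).symm.trans
    (congrArg (extChartAt (cotModel n) x β).2 h1.symm))
  exact (congrArg (β.snd : TangentSpace (𝓡 n) β.proj →L[ℝ] ℝ) h2).symm

theorem formInChart_tautForm {x : CotBundle n N} {z : PhaseSpace n}
    (hz : z ∈ (extChartAt (cotModel n) x).target) : formInChart tautForm x z = modelTaut n z := by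
  have hs := (extChartAt (cotModel n) x).map_target hz
  have hd := (germDiffeo_extChartAt hs).mfderiv_right_inv.self_of_nhds
  have hr := (extChartAt (cotModel n) x).right_inv hz
  refine ContinuousLinearMap.ext fun v => (tautForm_eq hs _).trans ?_
  rw [hr] at hd ⊢
  exact congrArg (modelTaut n z) (hd v)

theorem sympForm_eq_self (x : CotBundle n N) (v w : TangentSpace (cotModel n) x) :
    sympForm x v w = modelSymp n
      (mfderiv (cotModel n) 𝓘(ℝ, PhaseSpace n) (extChartAt (cotModel n) x) x v)
      (mfderiv (cotModel n) 𝓘(ℝ, PhaseSpace n) (extChartAt (cotModel n) x) x w) := by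
  have h : formInChart tautForm x =ᶠ[𝓝 (extChartAt (cotModel n) x x)] modelTaut n := by
    filter_upwards [extChartAt_target_mem_nhds x] with z hz using formInChart_tautForm hz
  have h' : fderiv ℝ (formInChart tautForm x) (extChartAt (cotModel n) x x) = modelTaut n := by
    rw [h.fderiv_eq]
    exact fderiv_bilin (P := PhaseSpace n) (modelTaut n) _
  unfold sympForm
  simp only [h']
  rfl

/-- In each chart of `T*N`, the canonical symplectic form is `dp_i ∧ dq^i`. -/
theorem sympForm_eq {x₀ x : CotBundle n N} (hx : x ∈ (extChartAt (cotModel n) x₀).source)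
    (v w : TangentSpace (cotModel n) x) :
    sympForm x v w = modelSymp n
      (mfderiv (cotModel n) 𝓘(ℝ, PhaseSpace n) (extChartAt (cotModel n) x₀) x v)
      (mfderiv (cotModel n) 𝓘(ℝ, PhaseSpace n) (extChartAt (cotModel n) x₀) x w) := by
  have h₀ := germDiffeo_extChartAt hx
  have h₁ := germDiffeo_extChartAt (I := cotModel n) (mem_extChartAt_source x)
  set φ₀ := extChartAt (cotModel n) x₀
  set φ := extChartAt (cotModel n) x
  have hψ := h₁.symm.trans h₀
  have hψd : ContDiffAt ℝ ∞ (φ₀ ∘ φ.symm) (φ x) := hψ.smooth.self_of_nhds.contDiffAt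
  have hmem : ∀ᶠ y in 𝓝 (φ x), φ.symm y ∈ φ₀.source :=
    h₁.symm.tendsto.eventually ((isOpen_extChartAt_source x₀).mem_nhds hx)
  have hD : ∀ᶠ y in 𝓝 (φ x), ∀ a : PhaseSpace n, fderiv ℝ (φ₀ ∘ φ.symm) y a =
      mfderiv (cotModel n) 𝓘(ℝ, PhaseSpace n) φ₀ (φ.symm y)
        (mfderiv 𝓘(ℝ, PhaseSpace n) (cotModel n) φ.symm y a) := by
    filter_upwards [h₁.smooth_inv, h₁.symm.tendsto.eventually h₀.smooth] with y hy hy' a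
    rw [← mfderiv_eq_fderiv,
      mfderiv_comp y (hy'.mdifferentiableAt (by simp)) (hy.mdifferentiableAt (by simp))]
    rfl
  -- Both charts express `ϑ` as `modelTaut`, so the transition map preserves it, and therefore
  -- preserves `modelSymp`.
  have h : ∀ᶠ y in 𝓝 (φ x), modelTaut n y =
      (modelTaut n ((φ₀ ∘ φ.symm) y)).comp (fderiv ℝ (φ₀ ∘ φ.symm) y) := by
    filter_upwards [hmem, extChartAt_target_mem_nhds x, hD] with y h1 h2 h3
    rw [← formInChart_tautForm h2]
    refine ContinuousLinearMap.ext fun a => (tautForm_eq h1 _).trans ?_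
    exact congrArg (modelTaut n (φ₀ (φ.symm y))) (h3 a).symm
  have key := extDerivBilin_fderiv (P := PhaseSpace n) hψd h
    (mfderiv (cotModel n) 𝓘(ℝ, PhaseSpace n) φ x v) (mfderiv (cotModel n) 𝓘(ℝ, PhaseSpace n) φ x w)
  have hD' : ∀ a : TangentSpace (cotModel n) x, fderiv ℝ (φ₀ ∘ φ.symm) (φ x)
      (mfderiv (cotModel n) 𝓘(ℝ, PhaseSpace n) φ x a) =
      mfderiv (cotModel n) 𝓘(ℝ, PhaseSpace n) φ₀ x a := by
    intro a
    refine (hD.self_of_nhds _).trans ?_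
    have e := h₁.mfderiv_left_inv.self_of_nhds a
    rw [h₁.map_inv]
    exact congrArg _ e
  rw [hD', hD'] at key
  rw [sympForm_eq_self]
  exact key.symm

theorem preservesForm_extChartAt (x : CotBundle n N) :
    PreservesForm (cotModel n) 𝓘(ℝ, PhaseSpace n) (extChartAt (cotModel n) x) x sympForm
      (fun _ a b => modelSymp n a b) := by
  filter_upwards [(isOpen_extChartAt_source (I := cotModel n) x).mem_nhds
    (mem_extChartAt_source x)] with y hy v w
  exact (sympForm_eq hy v w).symm

end Chart

/-! ### First variation of the action and the Noether argument in a vector space -/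

section FirstVariation

variable {P : Type*} [NormedAddCommGroup P] [NormedSpace ℝ P]

/-- Compactness of `[a, b]` provides an `ε` uniform in `t`; it makes linear variations admissible.
-/
theorem exists_forall_add_smul_mem {O : Set P} (hO : IsOpen O) {c ζ : ℝ → P} {a b : ℝ}
    (hc : ContinuousOn c (Set.Icc a b)) (hζ : ContinuousOn ζ (Set.Icc a b))
    (hcO : ∀ t ∈ Set.Icc a b, c t ∈ O) :
    ∃ ε : ℝ, 0 < ε ∧ ∀ t ∈ Set.Icc a b, ∀ s ∈ Set.Icc (-ε) ε, c t + s • ζ t ∈ O := by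
  have h1 : ∀ᶠ s in 𝓝 (0 : ℝ), ∀ t ∈ Set.Icc a b, c t + s • ζ t ∈ O := by
    have hcont : Continuous fun q : ℝ × Set.Icc a b => c q.2 + q.1 • ζ q.2 := by
      have h1 : Continuous fun t : Set.Icc a b => c t :=
        continuousOn_iff_continuous_domRestrict.1 hc
      have h2 : Continuous fun t : Set.Icc a b => ζ t :=
        continuousOn_iff_continuous_domRestrict.1 hζ
      exact (h1.comp continuous_snd).add (continuous_fst.smul (h2.comp continuous_snd))
    have h2 : ∀ t ∈ (Set.univ : Set (Set.Icc a b)), ∀ᶠ q in 𝓝 ((0 : ℝ), t),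
        c q.2 + q.1 • ζ q.2 ∈ O := by
      intro t _
      exact hcont.continuousAt.eventually (hO.mem_nhds (by simpa using hcO t t.2))
    have h3 := isCompact_univ.eventually_forall_of_forall_eventually
      (P := fun (s : ℝ) (t : Set.Icc a b) => c t + s • ζ t ∈ O) h2
    filter_upwards [h3] with s hs t ht using hs ⟨t, ht⟩ trivial
  obtain ⟨r, hr, hball⟩ := Metric.eventually_nhds_iff_ball.1 h1
  refine ⟨r / 2, by positivity, fun t ht s hs => hball s ?_ t ht⟩
  rw [mem_ball_zero_iff, Real.norm_eq_abs]
  exact lt_of_le_of_lt (abs_le.2 hs) (by linarith)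

/-- The first variation formula for the action of the 1-form `z ↦ L z` and the Hamiltonian `h`. -/
theorem hasDerivAt_action (L : P →L[ℝ] P →L[ℝ] ℝ) {h : P → ℝ} {O : Set P} (hO : IsOpen O)
    (hh : ContDiffOn ℝ ∞ h O) {J : Set ℝ} (hJ : IsOpen J) {c ζ : ℝ → P}
    (hc : ContDiffOn ℝ ∞ c J) (hζ : ContDiffOn ℝ ∞ ζ J) {a b : ℝ} (hab : a < b)
    (habJ : Set.Icc a b ⊆ J) (hcO : ∀ t ∈ Set.Icc a b, c t ∈ O) (hζa : ζ a = 0) (hζb : ζ b = 0) :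
    HasDerivAt (fun s : ℝ => ∫ t in a..b, (L (c t + s • ζ t)
      (derivWithin (fun r => c r + s • ζ r) (Set.Icc a b) t) - h (c t + s • ζ t)))
      (∫ t in a..b, (extDerivBilin L (ζ t) (deriv c t) - fderiv ℝ h (c t) (ζ t))) 0 := by
  have hcd : ∀ t ∈ Set.Icc a b, HasDerivAt c (deriv c t) t := fun t ht =>
    ((hc.contDiffAt (hJ.mem_nhds (habJ ht))).differentiableAt (by simp)).hasDerivAt
  have hζd : ∀ t ∈ Set.Icc a b, HasDerivAt ζ (deriv ζ t) t := fun t ht =>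
    ((hζ.contDiffAt (hJ.mem_nhds (habJ ht))).differentiableAt (by simp)).hasDerivAt
  have hc0 : ContinuousOn c (Set.Icc a b) := hc.continuousOn.mono habJ
  have hζ0 : ContinuousOn ζ (Set.Icc a b) := hζ.continuousOn.mono habJ
  have hc1 : ContinuousOn (deriv c) (Set.Icc a b) :=
    (hc.continuousOn_deriv_of_isOpen hJ (by simp)).mono habJ
  have hζ1 : ContinuousOn (deriv ζ) (Set.Icc a b) :=
    (hζ.continuousOn_deriv_of_isOpen hJ (by simp)).mono habJ
  have hh1 : ContinuousOn (fderiv ℝ h) O := hh.continuousOn_fderiv_of_isOpen hO (by simp)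
  obtain ⟨ε, hε, hεO⟩ := exists_forall_add_smul_mem hO hc0 hζ0 hcO
  have hint : ∀ s : ℝ, ∫ t in a..b, (L (c t + s • ζ t)
      (derivWithin (fun r => c r + s • ζ r) (Set.Icc a b) t) - h (c t + s • ζ t)) =
      ∫ t in a..b, (L (c t + s • ζ t) (deriv c t + s • deriv ζ t) - h (c t + s • ζ t)) := by
    intro s
    refine intervalIntegral.integral_congr fun t ht => ?_
    rw [Set.uIcc_of_le hab.le] at ht
    have h1 : HasDerivAt (fun r => c r + s • ζ r) (deriv c t + s • deriv ζ t) t :=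
      (hcd t ht).add ((hζd t ht).const_smul s)
    show L _ (derivWithin _ _ t) - _ = _
    rw [h1.hasDerivWithinAt.derivWithin (uniqueDiffOn_Icc hab t ht)]
  simp only [hint]
  let D : ℝ → ℝ → ℝ := fun s t => L (ζ t) (deriv c t + s • deriv ζ t) +
    L (c t + s • ζ t) (deriv ζ t) - fderiv ℝ h (c t + s • ζ t) (ζ t)
  have hpath : ContinuousOn (fun q : ℝ × ℝ => c q.2 + q.1 • ζ q.2)
      (Set.Icc (-ε) ε ×ˢ Set.Icc a b) := by
    have e : Set.MapsTo Prod.snd (Set.Icc (-ε) ε ×ˢ Set.Icc a b) (Set.Icc a b) := fun q hq => hq.2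
    exact (hc0.comp continuousOn_snd e).add (continuousOn_fst.smul (hζ0.comp continuousOn_snd e))
  have hDcont : ContinuousOn (fun q : ℝ × ℝ => D q.1 q.2) (Set.Icc (-ε) ε ×ˢ Set.Icc a b) := by
    have e : Set.MapsTo Prod.snd (Set.Icc (-ε) ε ×ˢ Set.Icc a b) (Set.Icc a b) := fun q hq => hq.2
    have e1 := hc1.comp continuousOn_snd e
    have e2 := hζ1.comp continuousOn_snd e
    have e3 := hζ0.comp continuousOn_snd e
    have e4 : ContinuousOn (fun q : ℝ × ℝ => fderiv ℝ h (c q.2 + q.1 • ζ q.2))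
        (Set.Icc (-ε) ε ×ˢ Set.Icc a b) := hh1.comp hpath fun q hq => hεO q.2 hq.2 q.1 hq.1
    exact (((L.continuous.comp_continuousOn e3).clm_apply (e1.add (continuousOn_fst.smul e2))).add
      ((L.continuous.comp_continuousOn hpath).clm_apply e2)).sub (e4.clm_apply e3)
  have hslice : ∀ s ∈ Set.Icc (-ε) ε, ContinuousOn (fun t => ((s, t) : ℝ × ℝ)) (Set.Icc a b) ∧
      Set.MapsTo (fun t => ((s, t) : ℝ × ℝ)) (Set.Icc a b) (Set.Icc (-ε) ε ×ˢ Set.Icc a b) :=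
    fun s hs => ⟨by fun_prop, fun t ht => ⟨hs, ht⟩⟩
  have hFcont : ∀ s ∈ Set.Icc (-ε) ε, ContinuousOn (fun t => L (c t + s • ζ t)
      (deriv c t + s • deriv ζ t) - h (c t + s • ζ t)) (Set.Icc a b) := by
    intro s hs
    have e1 : ContinuousOn (fun t => c t + s • ζ t) (Set.Icc a b) := hc0.add (hζ0.const_smul s)
    exact ((L.continuous.comp_continuousOn e1).clm_apply (hc1.add (hζ1.const_smul s))).sub
      (hh.continuousOn.comp e1 fun t ht => hεO t ht s hs)
  have h0 : (0 : ℝ) ∈ Set.Icc (-ε) ε := ⟨by linarith, hε.le⟩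
  have hsub : Set.uIoc a b ⊆ Set.Icc a b := by
    rw [Set.uIoc_of_le hab.le]
    exact Set.Ioc_subset_Icc_self
  obtain ⟨C, hC⟩ := (isCompact_Icc.prod isCompact_Icc).exists_bound_of_continuousOn hDcont
  have hnhds : Set.Icc (-ε) ε ∈ 𝓝 (0 : ℝ) := Icc_mem_nhds (by linarith) hε
  have key := (intervalIntegral.hasDerivAt_integral_of_dominated_loc_of_deriv_le
    (μ := MeasureTheory.volume) (a := a) (b := b) (x₀ := (0 : ℝ)) (F' := D) (bound := fun _ => C)
    (F := fun s t => L (c t + s • ζ t) (deriv c t + s • deriv ζ t) - h (c t + s • ζ t))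
    hnhds
    (by
      filter_upwards [hnhds] with s hs
      exact ((hFcont s hs).mono hsub).aestronglyMeasurable measurableSet_uIoc)
    (by
      refine ContinuousOn.intervalIntegrable ?_
      rw [Set.uIcc_of_le hab.le]
      exact hFcont 0 h0)
    (((hDcont.comp (hslice 0 h0).1 (hslice 0 h0).2).mono hsub).aestronglyMeasurable
      measurableSet_uIoc)
    (Eventually.of_forall fun t ht s hs => hC (s, t) ⟨hs, hsub ht⟩)
    (by simp)
    (Eventually.of_forall fun t ht s hs => by
      have e1 : HasDerivAt (fun s : ℝ => c t + s • ζ t) (ζ t) s := by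
        simpa using ((hasDerivAt_id s).smul_const (ζ t)).const_add (c t)
      have e2 : HasDerivAt (fun s : ℝ => deriv c t + s • deriv ζ t) (deriv ζ t) s := by
        simpa using ((hasDerivAt_id s).smul_const (deriv ζ t)).const_add (deriv c t)
      have e3 := (L.hasFDerivAt.comp_hasDerivAt s e1).clm_apply e2
      have e4 := ((hh.contDiffAt (hO.mem_nhds (hεO t (hsub ht) s hs))).differentiableAt
        (by simp)).hasFDerivAt.comp_hasDerivAt s e1
      exact e3.sub e4)).2
  refine key.congr_deriv ?_
  -- Integration by parts: with `ζ` zero at both ends, the derivative of `L (c t) (ζ t)` integrates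
  -- to `0`, and subtracting it leaves the antisymmetric part of `L`.
  have hparts : ∫ t in a..b, (L (deriv c t) (ζ t) + L (c t) (deriv ζ t)) = 0 := by
    have e := intervalIntegral.integral_eq_sub_of_hasDerivAt (a := a) (b := b)
      (f := fun t => L (c t) (ζ t)) (f' := fun t => L (deriv c t) (ζ t) + L (c t) (deriv ζ t))
      (fun t ht => by
        rw [Set.uIcc_of_le hab.le] at ht
        exact (L.hasFDerivAt.comp_hasDerivAt t (hcd t ht)).clm_apply (hζd t ht))
      (by
        refine ContinuousOn.intervalIntegrable ?_
        rw [Set.uIcc_of_le hab.le]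
        exact ((L.continuous.comp_continuousOn hc1).clm_apply hζ0).add
          ((L.continuous.comp_continuousOn hc0).clm_apply hζ1))
    simpa [hζa, hζb] using e
  refine (sub_zero (∫ t in a..b, D 0 t)).symm.trans
    ((congrArg (fun r => (∫ t in a..b, D 0 t) - r) hparts.symm).trans ?_)
  rw [← intervalIntegral.integral_sub]
  · refine intervalIntegral.integral_congr fun t _ => ?_
    simp only [D, zero_smul, add_zero, extDerivBilin_apply]
    ring
  · refine ContinuousOn.intervalIntegrable ?_
    rw [Set.uIcc_of_le hab.le]
    exact hDcont.comp (hslice 0 h0).1 (hslice 0 h0).2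
  · refine ContinuousOn.intervalIntegrable ?_
    rw [Set.uIcc_of_le hab.le]
    exact ((L.continuous.comp_continuousOn hc1).clm_apply hζ0).add
      ((L.continuous.comp_continuousOn hc0).clm_apply hζ1)

/-- If the action of `h` is stationary at `c`, then the function `f` with Hamiltonian vector field
`y` is constant along `c`, provided `h` is constant along `y`. -/
theorem deriv_eq_zero_of_stationary (L : P →L[ℝ] P →L[ℝ] ℝ) {h f : P → ℝ} {y : P → P} {O : Set P}
    (hO : IsOpen O) (hh : ContDiffOn ℝ ∞ h O) (hf : ContDiffOn ℝ ∞ f O) (hy : ContDiffOn ℝ ∞ y O)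
    (hfy : ∀ z ∈ O, ∀ w, extDerivBilin L (y z) w = fderiv ℝ f z w)
    (hhy : ∀ z ∈ O, fderiv ℝ h z (y z) = 0)
    {J : Set ℝ} (hJ : IsOpen J) {c : ℝ → P} (hc : ContDiffOn ℝ ∞ c J) (hcO : Set.MapsTo c J O)
    (hstat : ∀ a b ε : ℝ, a < b → Set.Icc a b ⊆ J → 0 < ε → ∀ F : ℝ × ℝ → P,
      ContDiffOn ℝ ∞ F (Set.Icc a b ×ˢ Set.Icc (-ε) ε) →
      Set.MapsTo F (Set.Icc a b ×ˢ Set.Icc (-ε) ε) O →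
      (∀ t ∈ Set.Icc a b, F (t, 0) = c t) → (∀ s ∈ Set.Icc (-ε) ε, F (a, s) = c a) →
      (∀ s ∈ Set.Icc (-ε) ε, F (b, s) = c b) →
      HasDerivAt (fun s => ∫ t in a..b, (L (F (t, s))
        (derivWithin (fun r => F (r, s)) (Set.Icc a b) t) - h (F (t, s)))) 0 0)
    {t₀ : ℝ} (ht₀ : t₀ ∈ J) : HasDerivAt (fun t => f (c t)) 0 t₀ := by
  have hk : ∀ t ∈ J, HasDerivAt (fun t => f (c t)) (extDerivBilin L (y (c t)) (deriv c t)) t := by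
    intro t ht
    rw [hfy _ (hcO ht)]
    exact ((hf.contDiffAt (hO.mem_nhds (hcO ht))).differentiableAt (by simp)).hasFDerivAt
      |>.comp_hasDerivAt t
        ((hc.contDiffAt (hJ.mem_nhds ht)).differentiableAt (by simp)).hasDerivAt
  have hyc : ContDiffOn ℝ ∞ (fun t => y (c t)) J := hy.comp hc hcO
  set k : ℝ → ℝ := fun t => extDerivBilin L (y (c t)) (deriv c t) with hkdef
  have hkc : ContinuousOn k J :=
    ((extDerivBilin L).continuous.comp_continuousOn hyc.continuousOn).clm_apply
      (hc.continuousOn_deriv_of_isOpen hJ (by simp))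
  suffices k t₀ = 0 by
    have := hk t₀ ht₀
    rwa [show extDerivBilin L (y (c t₀)) (deriv c t₀) = 0 from ‹k t₀ = 0›] at this
  by_contra hne
  -- Multiplying by `k t₀` handles both signs at once: `k t * k t₀` is positive near `t₀`.
  have hpos : ∀ᶠ t in 𝓝 t₀, t ∈ J ∧ 0 < k t * k t₀ := by
    refine Eventually.and (hJ.mem_nhds ht₀) ?_
    have : ContinuousAt (fun t => k t * k t₀) t₀ :=
      (hkc.continuousAt (hJ.mem_nhds ht₀)).mul continuousAt_const
    exact this.eventually (lt_mem_nhds (mul_self_pos.2 hne))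
  obtain ⟨δ, hδ, hball⟩ := Metric.nhds_basis_closedBall.eventually_iff.1 hpos
  let η : ContDiffBump t₀ := ⟨δ / 2, δ, by positivity, by linarith⟩
  have hη : ContDiff ℝ ∞ η := η.contDiff
  have hsupp : Function.support η = Set.Ioo (t₀ - δ) (t₀ + δ) := by
    rw [η.support_eq, Real.ball_eq_Ioo]
  rw [Real.closedBall_eq_Icc] at hball
  have hηa : η (t₀ - δ) = 0 := by
    rw [← Function.notMem_support, hsupp]
    simp
  have hηb : η (t₀ + δ) = 0 := by
    rw [← Function.notMem_support, hsupp]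
    simp
  have hab : t₀ - δ < t₀ + δ := by linarith
  have habJ : Set.Icc (t₀ - δ) (t₀ + δ) ⊆ J := fun t ht => (hball ht).1
  -- The variation along the Hamiltonian field of `f`, localised at `t₀` and zero at both ends. As
  -- `dh(y) = 0`, its first variation is the integral of `η k`.
  let ζ : ℝ → P := fun t => η t • y (c t)
  have hζ : ContDiffOn ℝ ∞ ζ J := hη.contDiffOn.smul hyc
  have hcO' : ∀ t ∈ Set.Icc (t₀ - δ) (t₀ + δ), c t ∈ O := fun t ht => hcO (habJ ht)
  obtain ⟨ε, hε, hεO⟩ := exists_forall_add_smul_mem hO (hc.continuousOn.mono habJ)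
    (hζ.continuousOn.mono habJ) hcO'
  have e : Set.MapsTo Prod.fst (Set.Icc (t₀ - δ) (t₀ + δ) ×ˢ Set.Icc (-ε) ε) J :=
    fun q hq => habJ hq.1
  have h1 := hstat _ _ ε hab habJ hε (fun q => c q.1 + q.2 • ζ q.1)
    ((hc.comp contDiffOn_fst e).add (contDiffOn_snd.smul (hζ.comp contDiffOn_fst e)))
    (fun q hq => hεO q.1 hq.1 q.2 hq.2) (fun t _ => by simp) (fun s _ => by simp [ζ, hηa])
    (fun s _ => by simp [ζ, hηb])
  have h2 := hasDerivAt_action L hO hh hJ hc hζ hab habJ hcO' (by simp [ζ, hηa])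
    (by simp [ζ, hηb])
  have h3 := h2.unique h1
  have h4 : ∫ t in (t₀ - δ)..(t₀ + δ), η t * (k t * k t₀) = 0 := by
    rw [← zero_mul (k t₀), ← h3, ← intervalIntegral.integral_mul_const]
    refine intervalIntegral.integral_congr fun t ht => ?_
    rw [Set.uIcc_of_le hab.le] at ht
    simp only [ζ, map_smul, smul_apply, smul_eq_mul, hhy _ (hcO' t ht), hkdef]
    ring
  have h5 : 0 < ∫ t in (t₀ - δ)..(t₀ + δ), η t * (k t * k t₀) := by
    refine intervalIntegral.intervalIntegral_pos_of_pos_on ?_ (fun t ht => ?_) hab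
    · refine ContinuousOn.intervalIntegrable ?_
      rw [Set.uIcc_of_le hab.le]
      exact hη.continuous.continuousOn.mul ((hkc.mono habJ).mul continuousOn_const)
    · refine mul_pos ?_ (hball (Set.Ioo_subset_Icc_self ht)).2
      have : t ∈ Function.support η := hsupp ▸ ht
      exact lt_of_le_of_ne η.nonneg (Ne.symm this)
  exact h5.ne' h4

end FirstVariation

/-! ### Hamiltonian symmetries yield first integrals -/

section Motion

variable {n : ℕ} {N : Type*} [TopologicalSpace N]
  [ChartedSpace (EuclideanSpace ℝ (Fin n)) N] [IsManifold (𝓡 n) ∞ N]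

/-- In a chart `ϑ` is `modelTaut`. Velocities are derivatives within `[a, b]`, since smoothness is
assumed only on that interval. -/
theorem hamAction_eq {H : CotBundle n N → ℝ} {x₀ : CotBundle n N} {a b : ℝ} (hab : a < b)
    {δ : ℝ → PhaseSpace n} (hδ : ContDiffOn ℝ ∞ δ (Set.Icc a b))
    (hmem : Set.MapsTo δ (Set.Icc a b) (extChartAt (cotModel n) x₀).target) :
    hamAction H a b (fun t => (extChartAt (cotModel n) x₀).symm (δ t)) =
      ∫ t in a..b, (modelTaut n (δ t) (derivWithin δ (Set.Icc a b) t) -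
        H ((extChartAt (cotModel n) x₀).symm (δ t))) := by
  set φ := extChartAt (cotModel n) x₀
  refine intervalIntegral.integral_congr fun t ht => ?_
  rw [Set.uIcc_of_le hab.le] at ht
  have hs : φ.symm (δ t) ∈ φ.source := φ.map_target (hmem ht)
  have h₀ := germDiffeo_extChartAt hs
  have hsm : MDifferentiableWithinAt 𝓘(ℝ, ℝ) (cotModel n) (fun r => φ.symm (δ r))
      (Set.Icc a b) t := by
    have e1 : ContMDiffWithinAt 𝓘(ℝ, ℝ) 𝓘(ℝ, PhaseSpace n) ∞ δ (Set.Icc a b) t :=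
      (hδ t ht).contMDiffWithinAt
    have e2 := ((contMDiffOn_extChartAt_symm (I := cotModel n) (n := ∞) x₀) _ (hmem ht)).comp t e1
      hmem
    exact e2.mdifferentiableWithinAt (by simp)
  have huniq : UniqueMDiffWithinAt 𝓘(ℝ, ℝ) (Set.Icc a b) t :=
    (uniqueDiffOn_Icc hab t ht).uniqueMDiffWithinAt
  have e1 := mfderiv_comp_mfderivWithin (I := 𝓘(ℝ, ℝ)) (I' := cotModel n)
    (I'' := 𝓘(ℝ, PhaseSpace n)) (g := φ) (f := fun r => φ.symm (δ r)) t
    (h₀.smooth.self_of_nhds.mdifferentiableAt (by simp)) hsm huniq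
  have e2 : mfderivWithin 𝓘(ℝ, ℝ) 𝓘(ℝ, PhaseSpace n) (φ ∘ fun r => φ.symm (δ r)) (Set.Icc a b) t =
      mfderivWithin 𝓘(ℝ, ℝ) 𝓘(ℝ, PhaseSpace n) δ (Set.Icc a b) t :=
    mfderivWithin_congr (fun r hr => φ.right_inv (hmem hr)) (φ.right_inv (hmem ht))
  have e3 : mfderiv (cotModel n) 𝓘(ℝ, PhaseSpace n) φ (φ.symm (δ t))
      (velocity (fun r => φ.symm (δ r)) (Set.Icc a b) t) = derivWithin δ (Set.Icc a b) t := by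
    have e4 := e1.symm.trans e2
    rw [mfderivWithin_eq_fderivWithin] at e4
    exact congrArg (fun A : ℝ →L[ℝ] PhaseSpace n => A 1) e4
  show tautForm (φ.symm (δ t)) (velocity (fun r => φ.symm (δ r)) (Set.Icc a b) t) -
    H (φ.symm (δ t)) * 1 = _
  rw [mul_one, tautForm_eq hs]
  congr 1
  refine (congrArg (modelTaut n (φ (φ.symm (δ t)))) e3).trans ?_
  rw [φ.right_inv (hmem ht)]

/-- A function whose Hamiltonian vector field preserves `H` is a first integral of `H`. -/
theorem isFirstIntegral_of_hamiltonian {H f : CotBundle n N → ℝ} {U V : Set (CotBundle n N)}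
    {Y : Π x : CotBundle n N, TangentSpace (cotModel n) x} (hV : IsOpen V) (hVU : V ⊆ U)
    (hH : ContMDiffOn (cotModel n) 𝓘(ℝ, ℝ) ∞ H U) (hf : ContMDiffOn (cotModel n) 𝓘(ℝ, ℝ) ∞ f V)
    (hY : ∀ x ∈ V, IsSmoothNear (cotModel n) x Y)
    (hfY : ∀ x ∈ V, ∀ w : TangentSpace (cotModel n) x, sympForm x (Y x) w = dform f x w)
    (hHY : ∀ x ∈ V, dform H x (Y x) = 0) : IsFirstIntegral H U V f := by
  refine ⟨hf, fun T γ hγ t₀ ht₀ ht₀V => ?_⟩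
  have htgt := isOpen_extChartAt_target (I := cotModel n) (γ t₀)
  have hsrc := isOpen_extChartAt_source (I := cotModel n) (γ t₀)
  have hcs := continuousOn_extChartAt_symm (I := cotModel n) (γ t₀)
  have hsm := contMDiffOn_extChartAt_symm (I := cotModel n) (n := ∞) (γ t₀)
  have hsm' := contMDiffOn_extChartAt (I := cotModel n) (n := ∞) (x := γ t₀)
  have hmem := mem_extChartAt_source (I := cotModel n) (γ t₀)
  have hgd : ∀ z ∈ (extChartAt (cotModel n) (γ t₀)).target, GermDiffeo (cotModel n)
      𝓘(ℝ, PhaseSpace n) (extChartAt (cotModel n) (γ t₀)) (extChartAt (cotModel n) (γ t₀)).symm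
      ((extChartAt (cotModel n) (γ t₀)).symm z) z := by
    intro z hz
    have := germDiffeo_extChartAt ((extChartAt (cotModel n) (γ t₀)).map_target hz)
    rwa [(extChartAt (cotModel n) (γ t₀)).right_inv hz] at this
  have hsymp := fun x hx => sympForm_eq (x₀ := γ t₀) (x := x) hx
  have hact := fun {a b : ℝ} (hab : a < b) (δ : ℝ → PhaseSpace n) =>
    hamAction_eq (H := H) (x₀ := γ t₀) hab (δ := δ)
  rw [← extChartAt_source (cotModel n)] at hsm'
  set φ := extChartAt (cotModel n) (γ t₀)
  -- The part of the chart lying in `V`. Variations with values in `O` lift through `φ.symm` to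
  -- variations of the motion in `U`, so stationarity can be tested in the vector space.
  let O : Set (PhaseSpace n) := φ.target ∩ φ.symm ⁻¹' V
  have hO : IsOpen O := hcs.isOpen_inter_preimage htgt hV
  have hOV : Set.MapsTo φ.symm O V := fun z hz => hz.2
  let y : PhaseSpace n → PhaseSpace n :=
    VectorField.mpullback 𝓘(ℝ, PhaseSpace n) (cotModel n) φ.symm Y
  have hpull : ∀ k : CotBundle n N → ℝ, ContMDiffOn (cotModel n) 𝓘(ℝ, ℝ) ∞ k V →
      ContDiffOn ℝ ∞ (k ∘ φ.symm) O ∧ ∀ z ∈ O, ∀ w : PhaseSpace n, fderiv ℝ (k ∘ φ.symm) z w =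
        dform k (φ.symm z) (mfderiv 𝓘(ℝ, PhaseSpace n) (cotModel n) φ.symm z w) := by
    intro k hk
    have e : ContMDiffOn 𝓘(ℝ, PhaseSpace n) 𝓘(ℝ, ℝ) ∞ (k ∘ φ.symm) O :=
      hk.comp (hsm.mono Set.inter_subset_left) hOV
    refine ⟨e.contDiffOn, fun z hz w => ?_⟩
    rw [← mfderiv_eq_fderiv, mfderiv_comp z
      ((hk.contMDiffAt (hV.mem_nhds hz.2)).mdifferentiableAt (by simp))
      ((hgd z hz.1).smooth_inv.self_of_nhds.mdifferentiableAt (by simp))]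
    rfl
  have hyval : ∀ z ∈ O, y z = mfderiv (cotModel n) 𝓘(ℝ, PhaseSpace n) φ (φ.symm z) (Y (φ.symm z)) :=
    fun z hz => ((hgd z hz.1).mpullback_eq Y).self_of_nhds
  have hy : ContDiffOn ℝ ∞ y O := by
    intro z hz
    have e : IsSmoothNear 𝓘(ℝ, PhaseSpace n) z y := (hY _ hz.2).mpullback (hgd z hz.1)
    exact (contMDiffAt_vectorSpace_iff_contDiffAt.1 e.self_of_nhds).contDiffWithinAt
  let J : Set ℝ := T ∩ γ ⁻¹' (φ.source ∩ V)
  have hJ : IsOpen J := hγ.smooth.continuousOn.isOpen_inter_preimage hγ.isOpen (hsrc.inter hV)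
  have hc : ContDiffOn ℝ ∞ (φ ∘ γ) J := by
    refine ContMDiffOn.contDiffOn ?_
    exact hsm'.comp (hγ.smooth.mono Set.inter_subset_left) fun t ht => ht.2.1
  have hcO : Set.MapsTo (φ ∘ γ) J O := fun t ht =>
    ⟨φ.map_source ht.2.1, by
      show φ.symm (φ (γ t)) ∈ V
      rw [φ.left_inv ht.2.1]
      exact ht.2.2⟩
  have key := deriv_eq_zero_of_stationary (P := PhaseSpace n) (modelTaut n) hO
    (hpull H (hH.mono hVU)).1 (hpull f hf).1 hy ?_ ?_ hJ hc hcO ?_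
    (t₀ := t₀) ⟨ht₀, hmem, ht₀V⟩
  · refine key.congr_of_eventuallyEq ?_
    filter_upwards [hJ.mem_nhds ⟨ht₀, hmem, ht₀V⟩] with t ht
    simp [φ.left_inv ht.2.1]
  · intro z hz w
    rw [(hpull f hf).2 z hz, ← hfY _ hz.2, hsymp _ (φ.map_target hz.1), hyval z hz]
    have e := (hgd z hz.1).symm.mfderiv_left_inv.self_of_nhds w
    exact (congrArg (modelSymp n _) e).symm
  · intro z hz
    rw [(hpull H (hH.mono hVU)).2 z hz, hyval z hz]
    have e := (hgd z hz.1).symm.mfderiv_right_inv.self_of_nhds (Y (φ.symm z))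
    exact (congrArg (dform H (φ.symm z)) e).trans (hHY _ hz.2)
  · intro a b ε hab habJ hε F hF hFO hF0 hFa hFb
    have hvar : IsVariation U γ a b ε (φ.symm ∘ F) := by
      refine ⟨?_, fun q hq => hVU (hFO hq).2, fun t ht => ?_, fun s hs => ?_, fun s hs => ?_⟩
      · exact hsm.comp hF.contMDiffOn fun q hq => (hFO hq).1
      · simp [hF0 t ht, φ.left_inv (habJ ht).2.1]
      · simp [hFa s hs, φ.left_inv (habJ (Set.left_mem_Icc.2 hab.le)).2.1]
      · simp [hFb s hs, φ.left_inv (habJ (Set.right_mem_Icc.2 hab.le)).2.1]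
    have h1 := hγ.stationary a b ε hab (fun t ht => (habJ ht).1) hε _ hvar
    refine h1.congr_of_eventuallyEq ?_
    filter_upwards [Icc_mem_nhds (neg_lt_zero.2 hε) hε] with s hs
    have e1 : Set.MapsTo (fun t => ((t, s) : ℝ × ℝ)) (Set.Icc a b)
      (Set.Icc a b ×ˢ Set.Icc (-ε) ε) := fun t ht => ⟨ht, hs⟩
    exact (hact hab (fun t => F (t, s)) (hF.comp (by fun_prop) e1)
      fun t ht => (hFO (e1 ht)).1).symm

/-- Near a point, a smooth function whose Hamiltonian vector field is a symmetry of `H` is a first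
integral of elementary type. -/
theorem mem_elemGerms_of_isHamGerm {H k : CotBundle n N → ℝ} {U : Set (CotBundle n N)}
    {u : CotBundle n N} (hU : IsOpen U) (hu : u ∈ U) (hH : ContMDiffOn (cotModel n) 𝓘(ℝ, ℝ) ∞ H U)
    (hk : ∀ᶠ x in 𝓝 u, ContMDiffAt (cotModel n) 𝓘(ℝ, ℝ) ∞ k x) {y : VFGerm (cotModel n) u}
    (hy : y ∈ spGerms H u) (hky : IsHamGerm (k : Germ (𝓝 u) ℝ) y) :
    (k : Germ (𝓝 u) ℝ) ∈ elemGerms H U u := by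
  obtain ⟨Y, hY, rfl, hsymm⟩ := hy
  obtain ⟨k', Z, hZ, hkk', hYZ, hham⟩ := hky
  have hkk : k =ᶠ[𝓝 u] k' := Germ.coe_eq.1 hkk'
  have hYZ' : Y =ᶠ[𝓝 u] Z := VFGerm.mk_eq_mk.1 hYZ
  obtain ⟨V, hVp, hV, huV⟩ := eventually_nhds_iff.1
    (hk.and (hZ.eventually_nhds.and (hham.and (hkk.eventuallyEq_nhds.and
      (hYZ'.and (hsymm.and (hU.mem_nhds hu)))))))
  refine ⟨V, k, hV, huV, fun x hx => (hVp x hx).2.2.2.2.2.2, ?_, rfl⟩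
  refine isFirstIntegral_of_hamiltonian (Y := Z) hV (fun x hx => (hVp x hx).2.2.2.2.2.2) hH
    (fun x hx => (hVp x hx).1.contMDiffWithinAt) (fun x hx => (hVp x hx).2.1) ?_ ?_
  · intro x hx w
    obtain ⟨-, -, h1, h2, -⟩ := hVp x hx
    rw [h1 w]
    exact congrArg (fun A : PhaseSpace n →L[ℝ] ℝ => A w)
      (h2.mfderiv_eq (I := cotModel n) (I' := 𝓘(ℝ, ℝ))).symm
  · intro x hx
    obtain ⟨-, -, -, -, h1, h2, -⟩ := hVp x hx
    rw [← h1]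
    exact h2.2

end Motion

/-! ### Pointwise consequences at all nearby base points -/

section GermDiffeoLocal

variable {E : Type*} [NormedAddCommGroup E] [NormedSpace ℝ E]
  {B : Type*} [TopologicalSpace B] {I : ModelWithCorners ℝ E B}
  {M : Type*} [TopologicalSpace M] [ChartedSpace B M]
  {E' : Type*} [NormedAddCommGroup E'] [NormedSpace ℝ E']
  {B' : Type*} [TopologicalSpace B'] {I' : ModelWithCorners ℝ E' B'}
  {M' : Type*} [TopologicalSpace M'] [ChartedSpace B' M']
  {f : M → M'} {g : M' → M} {u : M} {u' : M'}

theorem GermDiffeo.eventually (h : GermDiffeo I I' f g u u') :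
    ∀ᶠ x in 𝓝 u, GermDiffeo I I' f g x (f x) := by
  filter_upwards [h.smooth.eventually_nhds, h.left_inv.eventually_nhds,
    h.tendsto.eventually h.smooth_inv.eventually_nhds,
    h.tendsto.eventually h.right_inv.eventually_nhds] with x h1 h2 h3 h4
  exact ⟨rfl, h2.self_of_nhds, h1, h3, h2, h4⟩

/-- The chain rule along a germ of diffeomorphism, for any real function. -/
theorem GermDiffeo.mfderiv_comp_apply (h : GermDiffeo I I' f g u (f u)) (k : M' → ℝ)
    (v : TangentSpace I u) :
    (mfderiv I 𝓘(ℝ, ℝ) (k ∘ f) u v : ℝ) = (mfderiv I' 𝓘(ℝ, ℝ)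
      k (f u) (mfderiv I I' f u v) : ℝ) := by
  have hf := h.smooth.self_of_nhds.mdifferentiableAt (by simp)
  have hg := h.smooth_inv.self_of_nhds.mdifferentiableAt (by simp)
  by_cases hk : MDifferentiableAt I' 𝓘(ℝ, ℝ) k (f u)
  · rw [mfderiv_comp u hk hf]
    rfl
  -- Differentiability passes back through the inverse `g`, so here both derivatives have the
  -- default value `0`. No smoothness of `k` is needed when the lemma is applied to `Ω(V, W)` or to
  -- an arbitrary germ.
  · have hk' : ¬MDifferentiableAt I 𝓘(ℝ, ℝ) (k ∘ f) u := by
      intro hkf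
      rw [← h.map_inv] at hkf
      have h1 := hkf.comp (f u) hg
      refine hk (h1.congr_of_eventuallyEq ?_)
      filter_upwards [h.right_inv] with x hx
      simp [hx]
    rw [mfderiv_zero_of_not_mdifferentiableAt hk, mfderiv_zero_of_not_mdifferentiableAt hk']
    rfl

theorem GermDiffeo.mpullback_apply_image (h : GermDiffeo I I' f g u (f u))
    (Y : Π x : M, TangentSpace I x) :
    VectorField.mpullback I' I g Y (f u) = mfderiv I I' f u (Y u) := by
  have h1 := (h.mpullback_eq Y).self_of_nhds
  rwa [h.map_inv] at h1

theorem GermDiffeo.mpullback_mpullback (h : GermDiffeo I I' f g u u')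
    (Y : Π x : M, TangentSpace I x) :
    VectorField.mpullback I I' f (VectorField.mpullback I' I g Y) =ᶠ[𝓝 u] Y := by
  filter_upwards [h.symm.mpullback_eq (VectorField.mpullback I' I g Y),
    h.eventually, h.mfderiv_left_inv] with x h1 h2 h3
  rw [h1, h2.mpullback_apply_image]
  exact h3 _

end GermDiffeoLocal

/-! ### Naturality of symmetries, Hamiltonian fields and Poisson brackets -/

section Transport

variable {n : ℕ} {N : Type*} [TopologicalSpace N]
  [ChartedSpace (EuclideanSpace ℝ (Fin n)) N] [IsManifold (𝓡 n) ∞ N]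
  {N' : Type*} [TopologicalSpace N']
  [ChartedSpace (EuclideanSpace ℝ (Fin n)) N'] [IsManifold (𝓡 n) ∞ N']
  {f : CotBundle n N → CotBundle n N'} {g : CotBundle n N' → CotBundle n N}
  {u : CotBundle n N} {u' : CotBundle n N'}

theorem sympForm_nondegenerate (x : CotBundle n N) {v w : TangentSpace (cotModel n) x}
    (h : ∀ a, sympForm x v a = sympForm x w a) : v = w := by
  have hx := germDiffeo_extChartAt (I := cotModel n) (mem_extChartAt_source x)
  have h1 := (isSymplectic_modelSymp n).nondegenerate
    (mfderiv (cotModel n) 𝓘(ℝ, PhaseSpace n) (extChartAt (cotModel n) x) x v -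
      mfderiv (cotModel n) 𝓘(ℝ, PhaseSpace n) (extChartAt (cotModel n) x) x w) (fun b => by
    have e := h (mfderiv 𝓘(ℝ, PhaseSpace n) (cotModel n) (extChartAt (cotModel n) x).symm
      (extChartAt (cotModel n) x x) b)
    have e' := (sympForm_eq_self x v _).symm.trans (e.trans (sympForm_eq_self x w _))
    have e2 := hx.mfderiv_right_inv.self_of_nhds b
    have e3 := (congrArg (modelSymp n _) e2).symm.trans (e'.trans (congrArg (modelSymp n _) e2))
    refine (congrArg (fun A : PhaseSpace n →L[ℝ] ℝ => A b) (map_sub (modelSymp n) _ _)).trans ?_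
    exact sub_eq_zero.2 e3)
  have h2 := hx.mfderiv_left_inv.self_of_nhds
  have h3 := congrArg (mfderiv 𝓘(ℝ, PhaseSpace n) (cotModel n) (extChartAt (cotModel n) x).symm
      (extChartAt (cotModel n) x x)) (sub_eq_zero.1 h1)
  exact (h2 v).symm.trans (h3.trans (h2 w))

/-- Nondegeneracy of `Ω` makes the choice in `hamField` irrelevant as soon as one solution exists.
-/
theorem hamField_eq {k : CotBundle n N → ℝ} {x : CotBundle n N} {v : TangentSpace (cotModel n) x}
    (h : ∀ w, sympForm x v w = dform k x w) : hamField k x = v := by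
  have h1 : ∀ w, sympForm x (hamField k x) w = dform k x w :=
    Classical.epsilon_spec (p := fun v => ∀ w, sympForm x v w = dform k x w) ⟨v, h⟩
  exact sympForm_nondegenerate x fun a => (h1 a).trans (h a).symm

/-- Each ingredient is natural: the derivative of a function by the chain rule, the brackets by
their pullback formula, and `Ω` by hypothesis. Pulling the test fields `V` and `W` back lets every
test at `f x` be answered at `x`. -/
theorem lieDerivSympForm_mpullback {x : CotBundle n N}
    (h : GermDiffeo (cotModel n) (cotModel n) f g x (f x))
    (hΩ : PreservesForm (cotModel n) (cotModel n) f x sympForm sympForm)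
    {Y : Π x : CotBundle n N, TangentSpace (cotModel n) x}
    {V W : Π x : CotBundle n N', TangentSpace (cotModel n) x} (hY : IsSmoothNear (cotModel n) x Y)
    (hV : IsSmoothNear (cotModel n) (f x) V) (hW : IsSmoothNear (cotModel n) (f x) W) :
    lieDerivSympForm (VectorField.mpullback (cotModel n) (cotModel n) g Y) V W (f x) =
      lieDerivSympForm Y (VectorField.mpullback (cotModel n) (cotModel n) f V)
        (VectorField.mpullback (cotModel n) (cotModel n) f W) x := by
  have hval : ∀ V : Π x : CotBundle n N', TangentSpace (cotModel n) x,
      ∀ᶠ z in 𝓝 x, mfderiv (cotModel n) (cotModel n) f z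
        (VectorField.mpullback (cotModel n) (cotModel n) f V z) = V (f z) := by
    intro V
    filter_upwards [h.symm.mpullback_eq V, h.mfderiv_right_inv] with z h1 h2
    rw [h1]
    exact h2 _
  have hbr : ∀ V : Π x : CotBundle n N', TangentSpace (cotModel n) x,
      IsSmoothNear (cotModel n) (f x) V →
      VectorField.mlieBracket (cotModel n)
        (VectorField.mpullback (cotModel n) (cotModel n) g Y) V (f x) =
      mfderiv (cotModel n) (cotModel n) f x (VectorField.mlieBracket (cotModel n) Y
        (VectorField.mpullback (cotModel n) (cotModel n) f V) x) := by
    intro V hV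
    have e1 := (mpullback_mlieBracket_eventually hY (hV.mpullback h.symm) h).self_of_nhds
    rw [h.mpullback_apply_image] at e1
    rw [e1]
    exact (EventuallyEq.rfl.mlieBracket_vectorField
      (h.symm.mpullback_mpullback V).symm).self_of_nhds
  have hfun : (fun y => sympForm y (V y) (W y)) ∘ f =ᶠ[𝓝 x] fun z =>
      sympForm z (VectorField.mpullback (cotModel n) (cotModel n) f V z)
        (VectorField.mpullback (cotModel n) (cotModel n) f W z) := by
    filter_upwards [hΩ, hval V, hval W] with z h1 h2 h3
    rw [← h1, h2, h3]
    rfl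
  have hx := hΩ.self_of_nhds
  have e1 : dform (fun y => sympForm y (V y) (W y)) (f x)
      (VectorField.mpullback (cotModel n) (cotModel n) g Y (f x)) =
      dform (fun z => sympForm z (VectorField.mpullback (cotModel n) (cotModel n) f V z)
        (VectorField.mpullback (cotModel n) (cotModel n) f W z)) x (Y x) := by
    rw [h.mpullback_apply_image]
    refine (h.mfderiv_comp_apply (fun y => sympForm y (V y) (W y)) (Y x)).symm.trans ?_
    exact congrArg (fun A : PhaseSpace n →L[ℝ] ℝ => A (Y x))
      (hfun.mfderiv_eq (I := cotModel n) (I' := 𝓘(ℝ, ℝ)))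
  unfold lieDerivSympForm
  rw [e1, hbr V hV, hbr W hW, ← (hval V).self_of_nhds, ← (hval W).self_of_nhds, hx, hx]

theorem pushGerm_mem_spGerms (h : GermDiffeo (cotModel n) (cotModel n) f g u u')
    (hΩ : PreservesForm (cotModel n) (cotModel n) f u sympForm sympForm)
    {H : CotBundle n N → ℝ} {H' : CotBundle n N' → ℝ} {r : ℝ}
    (hHs : ∀ᶠ x in 𝓝 u, MDifferentiableAt (cotModel n) 𝓘(ℝ, ℝ) H x)
    (hH : ∀ᶠ x in 𝓝 u, H' (f x) = H x + r) {y : VFGerm (cotModel n) u} (hy : y ∈ spGerms H u) :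
    pushGerm h y ∈ spGerms H' u' := by
  obtain ⟨Y, hY, rfl, hsymm⟩ := hy
  refine ⟨_, hY.mpullback h, pushGerm_mk h hY, ?_⟩
  have hev : ∀ᶠ x in 𝓝 u, IsSympSymmetryAt H'
      (VectorField.mpullback (cotModel n) (cotModel n) g Y) (f x) := by
    filter_upwards [h.eventually, hΩ.eventually_nhds, hY.eventually_nhds, hsymm, hHs,
      hH.eventually_nhds] with x h1 h2 h3 h4 h5 h6
    refine ⟨fun V W hV hW => ?_, ?_⟩
    · rw [lieDerivSympForm_mpullback h1 h2 h3 hV hW]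
      exact h4.1 _ _ (hV.mpullback h1.symm) (hW.mpullback h1.symm)
    · rw [h1.mpullback_apply_image]
      refine (h1.mfderiv_comp_apply H' (Y x)).symm.trans ?_
      have e1 : H' ∘ f =ᶠ[𝓝 x] (fun t : ℝ => t + r) ∘ H := h6
      have e2 : MDifferentiableAt 𝓘(ℝ, ℝ) 𝓘(ℝ, ℝ) (fun t : ℝ => t + r) (H x) :=
        (by fun_prop : DifferentiableAt ℝ (fun t : ℝ => t + r) (H x)).mdifferentiableAt
      rw [e1.mfderiv_eq, mfderiv_comp x e2 h5]
      have e3 : mfderiv (cotModel n) 𝓘(ℝ, ℝ) H x (Y x) = (0 : ℝ) := h4.2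
      exact (congrArg (mfderiv 𝓘(ℝ, ℝ) 𝓘(ℝ, ℝ) (fun t : ℝ => t + r) (H x)) e3).trans (map_zero _)
  filter_upwards [h.symm.tendsto.eventually hev, h.right_inv] with x h1 h2
  rwa [h2] at h1

/-- Push-forward of germs of functions. -/
noncomputable def pushFun (h : GermDiffeo (cotModel n) (cotModel n) f g u u') (k : Germ (𝓝 u) ℝ) :
    Germ (𝓝 u') ℝ :=
  k.compTendsto g h.symm.tendsto

theorem pushFun_symm_pushFun (h : GermDiffeo (cotModel n) (cotModel n) f g u u')
    (k : Germ (𝓝 u) ℝ) : pushFun h.symm (pushFun h k) = k := by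
  induction k using Germ.inductionOn with
  | _ k =>
    refine Germ.coe_eq.2 ?_
    filter_upwards [h.left_inv] with x hx
    simp [hx]

theorem pushForward_isHamiltonian (h : GermDiffeo (cotModel n) (cotModel n) f g u u')
    (hΩ : PreservesForm (cotModel n) (cotModel n) f u sympForm sympForm)
    {k : CotBundle n N → ℝ} {Y : Π x : CotBundle n N, TangentSpace (cotModel n) x}
    (hkY : ∀ᶠ x in 𝓝 u, ∀ w : TangentSpace (cotModel n) x, sympForm x (Y x) w = dform k x w) :
    ∀ᶠ x in 𝓝 u', ∀ w : TangentSpace (cotModel n) x,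
      sympForm x (VectorField.mpullback (cotModel n) (cotModel n) g Y x) w =
        dform (k ∘ g) x w := by
  have hev : ∀ᶠ x in 𝓝 u, ∀ w : TangentSpace (cotModel n) (f x),
      sympForm (f x) (VectorField.mpullback (cotModel n) (cotModel n) g Y (f x)) w =
        dform (k ∘ g) (f x) w := by
    filter_upwards [h.eventually, hΩ, hkY, h.mfderiv_right_inv] with x h1 h2 h3 h4 w
    rw [h1.mpullback_apply_image]
    have h5 : GermDiffeo (cotModel n) (cotModel n) g f (f x) (g (f x)) := by
      rw [h1.map_inv]
      exact h1.symm
    refine Eq.trans ?_ (h5.mfderiv_comp_apply k w).symm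
    have e2 := h3 (mfderiv (cotModel n) (cotModel n) g (f x) w)
    have e3 := h2 (Y x) (mfderiv (cotModel n) (cotModel n) g (f x) w)
    rw [h4 w] at e3
    refine e3.trans (e2.trans ?_)
    rw [h1.map_inv]
    rfl
  filter_upwards [h.symm.tendsto.eventually hev, h.right_inv] with x h1 h2
  rwa [h2] at h1

theorem IsHamGerm.push (h : GermDiffeo (cotModel n) (cotModel n) f g u u')
    (hΩ : PreservesForm (cotModel n) (cotModel n) f u sympForm sympForm)
    {k : Germ (𝓝 u) ℝ} {y : VFGerm (cotModel n) u} (hky : IsHamGerm k y) :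
    IsHamGerm (pushFun h k) (pushGerm h y) := by
  obtain ⟨k, Y, hY, rfl, rfl, hham⟩ := hky
  exact ⟨k ∘ g, _, hY.mpullback h, rfl, pushGerm_mk h hY, pushForward_isHamiltonian h hΩ hham⟩

/-- Only the first argument needs a Hamiltonian field, to replace `hamField` by a field that is
known to transform; the second enters through its differential alone. -/
theorem pushFun_poissonGerm (h : GermDiffeo (cotModel n) (cotModel n) f g u u')
    (hΩ : PreservesForm (cotModel n) (cotModel n) f u sympForm sympForm)
    {k : Germ (𝓝 u) ℝ} (l : Germ (𝓝 u) ℝ) {y : VFGerm (cotModel n) u} (hky : IsHamGerm k y) :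
    pushFun h (poissonGerm k l) = poissonGerm (pushFun h k) (pushFun h l) := by
  obtain ⟨k, Y, hY, rfl, rfl, hham⟩ := hky
  induction l using Germ.inductionOn with
  | _ l =>
    refine Germ.coe_eq.2 ?_
    filter_upwards [h.symm.tendsto.eventually hham, pushForward_isHamiltonian h hΩ hham,
      h.symm.eventually, h.mpullback_eq Y, h.symm.mfderiv_right_inv] with x h1 h2 h3 h4 h5
    show dform l (g x) (hamField k (g x)) = dform (l ∘ g) x (hamField (k ∘ g) x)
    rw [hamField_eq h1, hamField_eq h2, h4]
    refine Eq.trans ?_ (h3.mfderiv_comp_apply l _).symm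
    exact congrArg (dform l (g x)) (h5 (Y (g x))).symm

end Transport

/-! ### Local conjugacy of Hamiltonians and transport of the Lie algebra -/

section Conjugation

variable {n : ℕ} {N : Type*} [TopologicalSpace N]
  [ChartedSpace (EuclideanSpace ℝ (Fin n)) N] [IsManifold (𝓡 n) ∞ N]
  {N' : Type*} [TopologicalSpace N']
  [ChartedSpace (EuclideanSpace ℝ (Fin n)) N'] [IsManifold (𝓡 n) ∞ N']

/-- In the chart around a regular point, a Hamiltonian is near that point a function which is smooth
on the whole model space, and regular at the image of the point. -/
theorem exists_contDiff_chart {H : CotBundle n N → ℝ} {u : CotBundle n N}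
    (hH : ∀ᶠ x in 𝓝 u, ContMDiffAt (cotModel n) 𝓘(ℝ, ℝ) ∞ H x) (hdH : dform H u ≠ 0) :
    ∃ H₀ : PhaseSpace n → ℝ, ContDiff ℝ ∞ H₀ ∧
      fderiv ℝ H₀ (extChartAt (cotModel n) u u) ≠ 0 ∧
      ∀ᶠ x in 𝓝 u, H₀ (extChartAt (cotModel n) u x) = H x := by
  have hφ := germDiffeo_extChartAt (I := cotModel n) (mem_extChartAt_source u)
  obtain ⟨H₀, h1, h2⟩ := exists_contDiff_eventuallyEq (P := PhaseSpace n)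
    (H := H ∘ (extChartAt (cotModel n) u).symm) (z := extChartAt (cotModel n) u u) (by
      filter_upwards [hφ.smooth_inv, hφ.symm.tendsto.eventually hH] with z h1 h2
      exact (h2.comp z h1).contDiffAt)
  have hev : H₀ ∘ extChartAt (cotModel n) u =ᶠ[𝓝 u] H := by
    filter_upwards [hφ.tendsto.eventually h2, hφ.left_inv] with x h3 h4
    exact h3.trans (congrArg H h4)
  refine ⟨H₀, h1, fun h0 => hdH ?_, hev⟩
  refine ContinuousLinearMap.ext fun v => ?_
  have e1 := hφ.mfderiv_comp_apply H₀ v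
  rw [mfderiv_eq_fderiv] at e1
  have e2 : dform H u = mfderiv (cotModel n) 𝓘(ℝ, ℝ) (H₀ ∘ extChartAt (cotModel n) u) u :=
    hev.symm.mfderiv_eq
  rw [e2]
  refine e1.trans ?_
  exact congrArg (fun A : PhaseSpace n →L[ℝ] ℝ =>
    A (mfderiv (cotModel n) 𝓘(ℝ, PhaseSpace n) (extChartAt (cotModel n) u) u v)) h0

/-- Near regular points, any two Hamiltonians are related, up to a constant, by a
symplectomorphism. -/
theorem exists_cot_symplectomorphism {H : CotBundle n N → ℝ} {u : CotBundle n N}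
    {H' : CotBundle n N' → ℝ} {u' : CotBundle n N'}
    (hH : ∀ᶠ x in 𝓝 u, ContMDiffAt (cotModel n) 𝓘(ℝ, ℝ) ∞ H x) (hdH : dform H u ≠ 0)
    (hH' : ∀ᶠ x in 𝓝 u', ContMDiffAt (cotModel n) 𝓘(ℝ, ℝ) ∞ H' x) (hdH' : dform H' u' ≠ 0) :
    ∃ (f : CotBundle n N → CotBundle n N') (g : CotBundle n N' → CotBundle n N) (r : ℝ),
      GermDiffeo (cotModel n) (cotModel n) f g u u' ∧
      PreservesForm (cotModel n) (cotModel n) f u sympForm sympForm ∧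
      ∀ᶠ x in 𝓝 u, H' (f x) = H x + r := by
  obtain ⟨H₀, h1, h2, h3⟩ := exists_contDiff_chart hH hdH
  obtain ⟨H₀', h1', h2', h3'⟩ := exists_contDiff_chart hH' hdH'
  obtain ⟨e, e', he, hΩ, hr⟩ := exists_symplectic_conjugation (P := PhaseSpace n)
    (isSymplectic_modelSymp n) h1 h1' h2 h2'
  have hφ := germDiffeo_extChartAt (I := cotModel n) (mem_extChartAt_source u)
  have hφ' := germDiffeo_extChartAt (I := cotModel n) (mem_extChartAt_source u')
  have hd := (hφ.trans he).trans hφ'.symm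
  refine ⟨_, _, H₀' (extChartAt (cotModel n) u' u') - H₀ (extChartAt (cotModel n) u u), hd,
    ((preservesForm_extChartAt u).trans hΩ hφ he).trans
    ((preservesForm_extChartAt u').symm hφ') (hφ.trans he) hφ'.symm, ?_⟩
  filter_upwards [h3, hφ.tendsto.eventually hr, hd.tendsto.eventually h3',
    (hφ.trans he).tendsto.eventually hφ'.right_inv] with x x1 x2 x3 x4
  rw [← x3, ← x1, ← x2]
  exact congrArg H₀' x4

variable {f : CotBundle n N → CotBundle n N'} {g : CotBundle n N' → CotBundle n N}
  {u : CotBundle n N} {u' : CotBundle n N'}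

theorem pushFun_add_const (h : GermDiffeo (cotModel n) (cotModel n) f g u u') (k : Germ (𝓝 u) ℝ)
    (c : ℝ) : pushFun h (k + Germ.const c) = pushFun h k + Germ.const c := by
  induction k using Germ.inductionOn with
  | _ k => rfl

/-- Push-forward along the inverse. The Poisson clause for the image is given Hamiltonian pairs at
`u'` and must return them to `u`. -/
theorem isHamGerm_of_push (h : GermDiffeo (cotModel n) (cotModel n) f g u u')
    (hΩ : PreservesForm (cotModel n) (cotModel n) f u sympForm sympForm)
    {k : Germ (𝓝 u) ℝ} {y : VFGerm (cotModel n) u}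
    (hky : IsHamGerm (pushFun h k) (pushGerm h y)) : IsHamGerm k y := by
  have := IsHamGerm.push h.symm (hΩ.symm h) hky
  rwa [pushFun_symm_pushFun, pushGerm_symm_pushGerm] at this

/-- A symplectomorphism which matches two Hamiltonians up to a constant carries the first integrals
that constitute a Lie algebra to first integrals that constitute its push-forward. -/
theorem Constitutes.push (h : GermDiffeo (cotModel n) (cotModel n) f g u u')
    (hΩ : PreservesForm (cotModel n) (cotModel n) f u sympForm sympForm)
    {H : CotBundle n N → ℝ} {H' : CotBundle n N' → ℝ} {r : ℝ}
    (hHs : ∀ᶠ x in 𝓝 u, MDifferentiableAt (cotModel n) 𝓘(ℝ, ℝ) H x)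
    (hr : ∀ᶠ x in 𝓝 u, H' (f x) = H x + r)
    {U : Set (CotBundle n N)} {U' : Set (CotBundle n N')} (hU' : IsOpen U') (hu' : u' ∈ U')
    (hH' : ContMDiffOn (cotModel n) 𝓘(ℝ, ℝ) ∞ H' U') {A : Set (Germ (𝓝 u) ℝ)}
    {𝔤 : LieSubalgebra ℝ (VFGerm (cotModel n) u)} (hA : Constitutes H U u A 𝔤) :
    Constitutes H' U' u' (pushFun h '' A)
      (𝔤.map (pushGermEquiv h : VFGerm (cotModel n) u →ₗ⁅ℝ⁆ VFGerm (cotModel n) u')) where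
  firstIntegral := by
    rintro _ ⟨k, hk, rfl⟩
    obtain ⟨y, hy, hky⟩ := hA.exists_ham k hk
    -- Only the smoothness of the original first integral is used; constancy along motions of `H'`
    -- follows from the pushed Hamiltonian symmetry.
    obtain ⟨V, k₀, hV, huV, -, hk₀, rfl⟩ := hA.firstIntegral hk
    refine mem_elemGerms_of_isHamGerm (k := k₀ ∘ g) hU' hu' hH' ?_
      (pushGerm_mem_spGerms h hΩ hHs hr (hA.subset_sp hy)) (IsHamGerm.push h hΩ hky)
    filter_upwards [h.smooth_inv, h.symm.tendsto.eventually (hV.mem_nhds huV)] with x h1 h2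
    exact (hk₀.smooth.contMDiffAt (hV.mem_nhds h2)).comp x h1
  subset_sp := by
    rintro _ ⟨y, hy, rfl⟩
    exact pushGerm_mem_spGerms h hΩ hHs hr (hA.subset_sp hy)
  exists_ham := by
    rintro _ ⟨k, hk, rfl⟩
    obtain ⟨y, hy, hky⟩ := hA.exists_ham k hk
    exact ⟨_, ⟨y, hy, rfl⟩, IsHamGerm.push h hΩ hky⟩
  exists_integral := by
    rintro _ ⟨y, hy, rfl⟩
    obtain ⟨k, hk, hky⟩ := hA.exists_integral y hy
    exact ⟨_, ⟨k, hk, rfl⟩, IsHamGerm.push h hΩ hky⟩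
  poisson := by
    rintro _ ⟨k, hk, rfl⟩ _ ⟨l, hl, rfl⟩ _ ⟨y, hy, rfl⟩ _ ⟨z, hz, rfl⟩ hky hlz
    have hky' := isHamGerm_of_push h hΩ hky
    obtain ⟨m, hm, hmyz, c, hc⟩ := hA.poisson k hk l hl y hy z hz hky' (isHamGerm_of_push h hΩ hlz)
    have hp := IsHamGerm.push h hΩ hmyz
    rw [pushGerm_lie] at hp
    refine ⟨_, ⟨m, hm, rfl⟩, hp, c, ?_⟩
    rw [hc, pushFun_add_const, pushFun_poissonGerm h hΩ l hky']

end Conjugation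

end HamSym
-- The theorem
theorem mainTheorem7 {n : ℕ}
    {N : Type*} [TopologicalSpace N] [T2Space N] [ChartedSpace (EuclideanSpace ℝ (Fin n)) N]
    [IsManifold (𝓡 n) ∞ N]
    {N' : Type*} [TopologicalSpace N'] [T2Space N'] [ChartedSpace (EuclideanSpace ℝ (Fin n)) N']
    [IsManifold (𝓡 n) ∞ N']
    (U : Set (HamSym.CotBundle n N)) (hU : IsOpen U) (H : HamSym.CotBundle n N → ℝ)
    (hH : ContMDiffOn (HamSym.cotModel n) 𝓘(ℝ, ℝ) ∞ H U)
    (u : HamSym.CotBundle n N) (hu : u ∈ U) (hdH : HamSym.dform H u ≠ 0)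
    (A : Set (Germ (𝓝 u) ℝ)) (𝔤 : LieSubalgebra ℝ (HamSym.VFGerm (HamSym.cotModel n) u))
    (hA : HamSym.Constitutes H U u A 𝔤)
    (U' : Set (HamSym.CotBundle n N')) (hU' : IsOpen U') (H' : HamSym.CotBundle n N' → ℝ)
    (hH' : ContMDiffOn (HamSym.cotModel n) 𝓘(ℝ, ℝ) ∞ H' U')
    (u' : HamSym.CotBundle n N') (hu' : u' ∈ U') (hdH' : HamSym.dform H' u' ≠ 0) :
    ∃ (A' : Set (Germ (𝓝 u') ℝ))
      (𝔤' : LieSubalgebra ℝ (HamSym.VFGerm (HamSym.cotModel n) u')),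
      HamSym.Constitutes H' U' u' A' 𝔤' ∧ Nonempty (𝔤 ≃ₗ⁅ℝ⁆ 𝔤') := by

  have hHs : ∀ᶠ x in 𝓝 u, ContMDiffAt (HamSym.cotModel n) 𝓘(ℝ, ℝ) ∞ H x := by
    filter_upwards [hU.mem_nhds hu] with x hx using hH.contMDiffAt (hU.mem_nhds hx)
  have hHs' : ∀ᶠ x in 𝓝 u', ContMDiffAt (HamSym.cotModel n) 𝓘(ℝ, ℝ) ∞ H' x := by
    filter_upwards [hU'.mem_nhds hu'] with x hx using hH'.contMDiffAt (hU'.mem_nhds hx)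
  obtain ⟨f, g, r, h, hΩ, hr⟩ := HamSym.exists_cot_symplectomorphism hHs hdH hHs' hdH'
  exact ⟨_, _, hA.push h hΩ (hHs.mono fun x hx => hx.mdifferentiableAt (by simp)) hr hU' hu' hH',
    ⟨(HamSym.pushGermEquiv h).lieSubalgebraMap 𝔤⟩⟩
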